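/- Let $k$ be a commutative ring, $\mathcal{C}$ a $k$-linear Grothendieck category and $(\mathcal{O}(n))_{n\in\mathbb{Z}}$ a collection of objects of $\mathcal{C}$. Let $\mathfrak{a}$ be the $k$-linear category with object set $\mathbb{Z}$, with $\mathfrak{a}(n,m)=\mathcal{C}(\mathcal{O}(-n),\mathcal{O}(-m))$ if $n\ge m$ and $\mathfrak{a}(n,m)=0$ otherwise, with the composition of $\mathcal{C}$, and let $u:\mathfrak{a}\to\mathcal{C}$, $n\mapsto\mathcal{O}(-n)$, be the natural functor. Let $\mathsf{Mod}(\mathfrak{a})$ be the category of $k$-linear functors $\mathfrak{a}^{\mathrm{op}}\to\mathsf{Mod}(k)$. A covering system $\mathcal{T}$ on $\mathfrak{a}$ consists of collections $\mathcal{T}(m)$ of subfunctors of $\mathfrak{a}(-,m)\in\mathsf{Mod}(\mathfrak{a})$, $m\in\mathbb{Z}$. It is a topology if $\mathfrak{a}(-,m)\in\mathcal{T}(m)$ for all $m$; if $f^{-1}R\in\mathcal{T}(n)$ for all $R\in\mathcal{T}(m)$ and $f\in\mathfrak{a}(n,m)$; and if a subfunctor $S\subseteq\mathfrak{a}(-,m)$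 is in $\mathcal{T}(m)$ whenever there is an $R\in\mathcal{T}(m)$ with $f^{-1}S\in\mathcal{T}(n)$ for all $n$ and $f\in R(n)$. A module $M\in\mathsf{Mod}(\mathfrak{a})$ is a $\mathcal{T}$-sheaf if for every $R\in\mathcal{T}(m)$ every morphism $R\to M$ extends uniquely to $\mathfrak{a}(-,m)$; $\mathsf{Sh}(\mathfrak{a},\mathcal{T})$ is the full subcategory of sheaves. A morphism $\varphi:M\to N$ in $\mathsf{Mod}(\mathfrak{a})$ is a $\mathcal{T}$-epimorphism if for every $y\in N(m)$ there is an $R\in\mathcal{T}(m)$ such that $N(g)(y)$ is in the image of $\varphi$ for every $g\in R$, and a $\mathcal{T}$-monomorphism if for every $x\in M(m)$ with $\varphi(x)=0$ there is an $R\in\mathcal{T}(m)$ such that $M(g)(x)=0$ for every $g\in R$. Let $\mathfrak{a}(-,m)_{\ge n}\subseteq\mathfrak{a}(-,m)$ be the subfunctor with value $\mathfrak{a}(l,m)$ at $l\ge n$ and $0$ at $l<n$. Let $\mathcal{L}_{\mathrm{tails}}(m)$ consist of the $R\subseteq\mathfrak{a}(-,m)$ with $\mathfrak{a}(-,m)_{\ge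 n}\subseteq R$ for some $n\ge m$, let $\mathcal{T}_{\mathrm{tails}}$ be the smallest topology containing $\mathcal{L}_{\mathrm{tails}}$, and put $\mathsf{Qmod}(\mathfrak{a})=\mathsf{Sh}(\mathfrak{a},\mathcal{T}_{\mathrm{tails}})$. The collection $(\mathcal{O}(n))_{n}$ is called $\mathbb{Z}$-generating if the functor $\mathcal{C}\to\mathsf{Mod}(\mathfrak{a})$, $C\mapsto\mathcal{C}(u(-),C)$, factors (up to isomorphism) through an equivalence $\mathcal{C}\cong\mathsf{Qmod}(\mathfrak{a})$. Suppose that $\mathcal{L}_{\mathrm{tails}}=\mathcal{T}_{\mathrm{tails}}$. Then $(\mathcal{O}(n))_{n\in\mathbb{Z}}$ is $\mathbb{Z}$-generating if and only if the following four conditions hold: (a) the objects $\mathcal{O}(n)$ generate $\mathcal{C}$, i.e. for every $C\in\mathcal{C}$ there is an epimorphism $\bigoplus_i\mathcal{O}(n_i)\to C$; (b) $u$ is $\mathcal{L}_{\mathrm{tails}}$-ample, i.e. for every $R\in\mathcal{L}_{\mathrm{tails}}(m)$ the canonical morphism $\bigoplus_{n,\,f\in R(n)}u(n)\to u(m)$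 is an epimorphism; (c) $u$ is $\mathcal{L}_{\mathrm{tails}}$-projective, i.e. for every epimorphism $X\to Y$ in $\mathcal{C}$ the morphism $\mathcal{C}(u(-),X)\to\mathcal{C}(u(-),Y)$ is an $\mathcal{L}_{\mathrm{tails}}$-epimorphism; (d) $u$ is $\mathcal{L}_{\mathrm{tails}}$-finitely presented, i.e. for every filtered colimit $\operatorname{colim}_iX_i$ in $\mathcal{C}$ the canonical morphism $\operatorname{colim}_i\mathcal{C}(u(-),X_i)\to\mathcal{C}(u(-),\operatorname{colim}_iX_i)$ is an $\mathcal{L}_{\mathrm{tails}}$-epimorphism and an $\mathcal{L}_{\mathrm{tails}}$-monomorphism. Moreover, (b), (c) and (d) are respectively equivalent to the following explicit conditions: (b') for all $m\le n$ there is an epimorphism $\bigoplus_i\mathcal{O}(-n_i)\to\mathcal{O}(-m)$ with $n_i\ge n$ for every $i$; (c') for every epimorphism $c:X\to Y$ in $\mathcal{C}$ and every morphism $f:\mathcal{O}(-m)\to Y$ there is an $n_0\ge m$ such that every composition $\mathcal{O}(-n)\to\mathcal{O}(-m)\xrightarrow{f}Y$ with $n\ge n_0$ factors through $c$; (d') for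 every filtered colimit $\operatorname{colim}_iX_i$ in $\mathcal{C}$: for every $f:\mathcal{O}(-m)\to\operatorname{colim}_iX_i$ there is an $n_0\ge m$ such that for every $n\ge n_0$ every composition $\mathcal{O}(-n)\to\mathcal{O}(-m)\xrightarrow{f}\operatorname{colim}_iX_i$ factors through $X_i\to\operatorname{colim}_iX_i$ for some $i$; and for every $f:\mathcal{O}(-m)\to X_i$ whose composition with $X_i\to\operatorname{colim}_iX_i$ is zero there is an $n_0\ge m$ such that for every $n\ge n_0$ every composition $\mathcal{O}(-n)\to\mathcal{O}(-m)\xrightarrow{f}X_i$ becomes zero when composed with a suitable $X_i\to X_j$. -/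

import Mathlib

open CategoryTheory CategoryTheory.Limits Opposite

universe w v u

noncomputable section

namespace LinTop

/-! ### Linear covering systems, topologies and sheaves on a small `k`-linear category -/

section General

variable (k : Type w) [CommRing k] {A : Type} [Category.{v} A] [Preadditive A] [Linear k A]

/-- A subfunctor, in the category of right `A`-modules, of the representable module `A(-, X)`. -/
@[ext]
structure LinearSieve (X : A) where
  /-- the submodule `R(Y) ⊆ A(Y, X)` -/
  carrier : ∀ Y : A, Submodule k (Y ⟶ X)
  comp_mem : ∀ {Y Z : A} (g : Z ⟶ Y) {f : Y ⟶ X}, f ∈ carrier Y → g ≫ f ∈ carrier Z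

variable {k}

namespace LinearSieve

/-- Inclusion of subfunctors. -/
instance (X : A) : LE (LinearSieve k X) where
  le R S := ∀ Y : A, R.carrier Y ≤ S.carrier Y

/-- The whole representable module `A(-, X)`. -/
def whole (X : A) : LinearSieve k X where
  carrier _ := ⊤
  comp_mem _ _ _ := Submodule.mem_top

/-- The pullback `f⁻¹R ⊆ A(-, Y)` of `R ⊆ A(-, X)` along `f : Y ⟶ X`. -/
def pullback {X Y : A} (R : LinearSieve k X) (f : Y ⟶ X) : LinearSieve k Y where
  carrier Z := (R.carrier Z).comap (Linear.rightComp k Z f)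
  comp_mem g h hh := by
    have := R.comp_mem g hh
    simpa using this

end LinearSieve

variable (k A) in
/-- A covering system: for every object a collection of subfunctors of the representable module. -/
abbrev CoveringSystem := ∀ X : A, Set (LinearSieve k X)

/-- The linearized axioms of a Grothendieck topology. -/
structure IsTopology (T : CoveringSystem k A) : Prop where
  identity : ∀ X : A, LinearSieve.whole X ∈ T X
  pullback : ∀ {X Y : A} (R : LinearSieve k X) (f : Y ⟶ X), R ∈ T X → R.pullback f ∈ T Y
  glueing : ∀ {X : A} (R S : LinearSieve k X), R ∈ T X →
    (∀ (Y : A) (f : Y ⟶ X), f ∈ R.carrier Y → S.pullback f ∈ T Y) → S ∈ T X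

/-- The smallest topology containing a covering system `L`: the intersection of all the topologies
that contain it. -/
def generatedTopology (L : CoveringSystem k A) : CoveringSystem k A := fun X =>
  {R | ∀ T : CoveringSystem k A, IsTopology T → (∀ Y : A, L Y ⊆ T Y) → R ∈ T X}

/-- The presheaf `M` of `k`-modules is a right `A`-module, i.e. a `k`-linear functor
`Aᵒᵖ ⥤ Mod k`. -/
structure IsRightModule (M : Aᵒᵖ ⥤ ModuleCat.{v} k) : Prop where
  map_add : ∀ {X Y : A} (f g : Y ⟶ X), M.map (f + g).op = M.map f.op + M.map g.op
  map_smul : ∀ {X Y : A} (r : k) (f : Y ⟶ X), M.map (r • f).op = r • M.map f.op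

/-- A morphism of modules from the submodule `R ⊆ A(-, X)` to `M`. -/
structure LinearSieve.HomTo {X : A} (R : LinearSieve k X) (M : Aᵒᵖ ⥤ ModuleCat.{v} k) where
  app : ∀ Y : A, R.carrier Y →ₗ[k] M.obj (op Y)
  naturality : ∀ {Y Z : A} (g : Z ⟶ Y) (f : R.carrier Y),
    app Z ⟨g ≫ f.1, R.comp_mem g f.2⟩ = (M.map g.op).hom (app Y f)

/-- The sheaf property: for every covering `R` of `X`, every morphism `R ⟶ M` extends uniquely to
`A(-, X)`, that is, it is `f ↦ M(f)(x)` for a unique `x ∈ M(X)`. -/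
def IsLinearSheaf (T : CoveringSystem k A) (M : Aᵒᵖ ⥤ ModuleCat.{v} k) : Prop :=
  ∀ (X : A) (R : LinearSieve k X), R ∈ T X → ∀ φ : R.HomTo M,
    ∃! x : M.obj (op X), ∀ (Y : A) (f : R.carrier Y), φ.app Y f = (M.map f.1.op).hom x

/-- The property defining `Sh(A, T)` as a full subcategory of all presheaves of `k`-modules. -/
def sheafProperty (T : CoveringSystem k A) : ObjectProperty (Aᵒᵖ ⥤ ModuleCat.{v} k) :=
  fun M => IsRightModule M ∧ IsLinearSheaf T M

/-- The category `Sh(A, T)` of linear sheaves. -/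
abbrev Sh (T : CoveringSystem k A) := (sheafProperty T).FullSubcategory

/-- `T`-epimorphisms. -/
def IsTEpi (T : CoveringSystem k A) {M N : Aᵒᵖ ⥤ ModuleCat.{v} k} (φ : M ⟶ N) : Prop :=
  ∀ (X : A) (y : N.obj (op X)), ∃ R ∈ T X, ∀ (Y : A) (g : Y ⟶ X), g ∈ R.carrier Y →
    ∃ x : M.obj (op Y), (φ.app (op Y)).hom x = (N.map g.op).hom y

/-- `T`-monomorphisms. -/
def IsTMono (T : CoveringSystem k A) {M N : Aᵒᵖ ⥤ ModuleCat.{v} k} (φ : M ⟶ N) : Prop :=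
  ∀ (X : A) (x : M.obj (op X)), (φ.app (op X)).hom x = 0 →
    ∃ R ∈ T X, ∀ (Y : A) (g : Y ⟶ X), g ∈ R.carrier Y → (M.map g.op).hom x = 0

variable {C : Type u} [Category.{v} C]

/-- The functor `C ↦ C(u(-), C)` induced by `u : A ⥤ C`. -/
def restrictedYoneda (k : Type w) [CommRing k] [Preadditive C] [Linear k C] (F : A ⥤ C) :
    C ⥤ Aᵒᵖ ⥤ ModuleCat.{v} k :=
  linearYoneda k C ⋙ (Functor.whiskeringLeft _ _ _).obj F.op

variable [Abelian C] [IsGrothendieckAbelian.{v} C]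

/-- `F` is `T`-ample: for every covering `R` of `X`, the canonical morphism
`⨁_{f ∈ R} F(dom f) ⟶ F(X)` is an epimorphism. -/
def IsTAmple (T : CoveringSystem k A) (F : A ⥤ C) : Prop :=
  ∀ (X : A) (R : LinearSieve k X), R ∈ T X →
    Epi (Sigma.desc (fun f : (Σ Y : A, R.carrier Y) => F.map f.2.1) :
      (∐ fun f : (Σ Y : A, R.carrier Y) => F.obj f.1) ⟶ F.obj X)

variable [Linear k C]

/-- `F` is `T`-projective: `C(F(-), X) ⟶ C(F(-), Y)` is a `T`-epimorphism for every
epimorphism `X ⟶ Y`. -/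
def IsTProjective (T : CoveringSystem k A) (F : A ⥤ C) : Prop :=
  ∀ {X Y : C} (c : X ⟶ Y), Epi c → IsTEpi T ((restrictedYoneda k F).map c)

/-- `F` is `T`-finitely presented: for filtered colimits, the canonical morphism
`colim C(F(-), X_i) ⟶ C(F(-), colim X_i)` is a `T`-epimorphism and a `T`-monomorphism. (Colimits of
right modules are computed in the category of all presheaves of `k`-modules.) -/
def IsTFinitelyPresented (T : CoveringSystem k A) (F : A ⥤ C) : Prop :=
  ∀ (J : Type v) [SmallCategory J] [IsFiltered J] (D : J ⥤ C),
    IsTEpi T (colimit.post D (restrictedYoneda k F)) ∧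
      IsTMono T (colimit.post D (restrictedYoneda k F))

end General

/-! ### The `ℤ`-algebra of a sequence of objects -/

section ZAlgebra

variable {C : Type u} [Category.{v} C]

/-- The objects of the `ℤ`-algebra associated with the sequence `O`: a copy of `ℤ`. -/
structure ZAlg (_O : ℤ → C) where
  deg : ℤ

variable [Preadditive C]

namespace ZAlg

variable {O : ℤ → C}

/-- The group `𝔞(n, m)`: it is all of `C(O(-n), O(-m))` if `n ≥ m`, and zero otherwise. -/
def homs (X Y : ZAlg O) : AddSubgroup (O (-X.deg) ⟶ O (-Y.deg)) where
  carrier := {f | X.deg < Y.deg → f = 0}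
  zero_mem' _ := rfl
  add_mem' hf hg h := by rw [hf h, hg h, add_zero]
  neg_mem' hf h := by rw [hf h, neg_zero]

instance : Category.{v} (ZAlg O) where
  Hom X Y := homs X Y
  id X := ⟨𝟙 _, fun h => absurd h (lt_irrefl _)⟩
  comp {X Y Z} f g := ⟨f.1 ≫ g.1, fun h => by
    rcases lt_or_ge X.deg Y.deg with h' | h'
    · rw [f.2 h', zero_comp]
    · rw [g.2 (lt_of_le_of_lt h' h), comp_zero]⟩
  id_comp f := Subtype.ext (Category.id_comp f.1)
  comp_id f := Subtype.ext (Category.comp_id f.1)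
  assoc f g h := Subtype.ext (Category.assoc f.1 g.1 h.1)

instance : Preadditive (ZAlg O) where
  homGroup X Y := inferInstanceAs (AddCommGroup (homs X Y))
  add_comp _ _ _ f f' g := Subtype.ext (Preadditive.add_comp _ _ _ f.1 f'.1 g.1)
  comp_add _ _ _ f g g' := Subtype.ext (Preadditive.comp_add _ _ _ f.1 g.1 g'.1)

instance (k : Type w) [CommRing k] [Linear k C] : Linear k (ZAlg O) where
  homModule X Y :=
    { smul := fun r f => ⟨r • f.1, fun h => by rw [f.2 h, smul_zero]⟩
      one_smul := fun f => Subtype.ext (one_smul k f.1)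
      mul_smul := fun r s f => Subtype.ext (mul_smul r s f.1)
      smul_zero := fun r => Subtype.ext (smul_zero r)
      smul_add := fun r f g => Subtype.ext (smul_add r f.1 g.1)
      add_smul := fun r s f => Subtype.ext (add_smul r s f.1)
      zero_smul := fun f => Subtype.ext (zero_smul k f.1) }
  smul_comp _ _ _ r f g := Subtype.ext (Linear.smul_comp _ _ _ r f.1 g.1)
  comp_smul _ _ _ f r g := Subtype.ext (Linear.comp_smul _ _ _ f.1 r g.1)

/-- The functor `u : 𝔞 ⥤ C`, `n ↦ O(-n)`. -/
def toC (O : ℤ → C) : ZAlg O ⥤ C where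
  obj X := O (-X.deg)
  map f := f.1
  map_id _ := rfl
  map_comp _ _ := rfl

variable (k : Type w) [CommRing k] [Linear k C]

/-- The truncation `𝔞(-, X)_{≥ n}` of the representable module `𝔞(-, X)`: its value at `Y` is all of
`𝔞(Y, X)` if `Y ≥ n`, and zero otherwise. -/
def tail (X : ZAlg O) (n : ℤ) : LinearSieve k X where
  carrier Y :=
    { carrier := {f | Y.deg < n → f = 0}
      zero_mem' := fun _ => rfl
      add_mem' := fun hf hg h => by rw [hf h, hg h, add_zero]
      smul_mem' := fun r f hf h => by rw [hf h, smul_zero] }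
  comp_mem {Y Z} g f hf h := by
    rcases lt_or_ge Y.deg n with h' | h'
    · rw [hf h', comp_zero]
    · have hg : g = 0 := Subtype.ext (g.2 (lt_of_lt_of_le h h'))
      rw [hg, zero_comp]

/-- The covering system `𝓛_tails`: `R` covers `X` if `𝔞(-, X)_{≥ n} ⊆ R` for some `n ≥ X`. -/
def LTails (O : ℤ → C) : CoveringSystem k (ZAlg O) := fun X =>
  {R | ∃ n : ℤ, X.deg ≤ n ∧ tail k X n ≤ R}

/-- The tails topology `𝓣_tails`: the smallest topology containing `𝓛_tails`. -/
def TTails (O : ℤ → C) : CoveringSystem k (ZAlg O) := generatedTopology (LTails k O)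

/-- The category `Qmod(𝔞)` of quasi-coherent modules. -/
abbrev Qmod (O : ℤ → C) := Sh (TTails k O)

/-- The sequence is `ℤ`-generating: the functor `C(u(-), -)` induced by `u` factors through an
equivalence of `C` with `Qmod(𝔞)`. -/
def IsZGenerating (O : ℤ → C) : Prop :=
  ∃ e : C ⥤ Qmod k O, e.IsEquivalence ∧
    Nonempty (e ⋙ (sheafProperty (TTails k O)).ι ≅ restrictedYoneda k (toC O))

end ZAlg

end ZAlgebra

/-! ### The explicit conditions -/

section Conditions

variable {C : Type u} [Category.{v} C] [Abelian C] [IsGrothendieckAbelian.{v} C]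

/-- Every object of `C` is a quotient of a coproduct of objects `O(n_i)`. -/
def Generates (O : ℤ → C) : Prop :=
  ∀ X : C, ∃ (I : Type v) (n : I → ℤ) (p : (∐ fun i => O (n i)) ⟶ X), Epi p

/-- For all `m ≤ n`, the object `O(-m)` is a quotient of a coproduct of objects `O(-n_i)` with
`n_i ≥ n`. -/
def TailsAmple (O : ℤ → C) : Prop :=
  ∀ m n : ℤ, m ≤ n → ∃ (I : Type v) (ν : I → ℤ) (p : (∐ fun i => O (-ν i)) ⟶ O (-m)),
    (∀ i, n ≤ ν i) ∧ Epi p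

/-- For every epimorphism `c : X ⟶ Y` and every `f : O(-m) ⟶ Y` there is `n₀ ≥ m` such that
all compositions `O(-n) ⟶ O(-m) ⟶ Y` with `n ≥ n₀` factor through `c`. -/
def TailsProjective (O : ℤ → C) : Prop :=
  ∀ (X Y : C) (c : X ⟶ Y), Epi c → ∀ (m : ℤ) (f : O (-m) ⟶ Y),
    ∃ n₀ : ℤ, m ≤ n₀ ∧ ∀ n : ℤ, n₀ ≤ n → ∀ g : O (-n) ⟶ O (-m),
      ∃ h : O (-n) ⟶ X, h ≫ c = g ≫ f

/-- Tail-wise lifting of morphisms to, and tail-wise detection of zero in, filtered colimits. -/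
def TailsFinitelyPresented (O : ℤ → C) : Prop :=
  ∀ (J : Type v) [SmallCategory J] [IsFiltered J] (D : J ⥤ C) (c : Cocone D), IsColimit c →
    ∀ m : ℤ,
      (∀ f : O (-m) ⟶ c.pt, ∃ n₀ : ℤ, m ≤ n₀ ∧ ∀ n : ℤ, n₀ ≤ n → ∀ g : O (-n) ⟶ O (-m),
        ∃ (i : J) (h : O (-n) ⟶ D.obj i), h ≫ c.ι.app i = g ≫ f) ∧
      (∀ (i : J) (f : O (-m) ⟶ D.obj i), f ≫ c.ι.app i = 0 →
        ∃ n₀ : ℤ, m ≤ n₀ ∧ ∀ n : ℤ, n₀ ≤ n → ∀ g : O (-n) ⟶ O (-m),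
          ∃ (j : J) (a : i ⟶ j), g ≫ f ≫ D.map a = 0)

end Conditions

end LinTop

end

open LinTop LinTop.ZAlg

noncomputable section

namespace LinTop

/-! ### Presheaves of modules, elementwise. -/

section Presheaf

variable {k : Type w} [CommRing k] {A : Type} [Category.{v} A]

/-! This is a linear Gabriel–Popescu theorem, proved for a topology `T` on `A` and a `k`-linear
functor `F : A ⥤ C`. For sufficiency, `F` must also be faithful and locally full (`IsTFull`). The
functor u is not full in general, since 𝔞(n, m) = 0 for n < m, but any O(-n) → O(-m) becomes a
morphism of 𝔞 after composition with maps from degrees at least max(n, m). So u is locally full for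
the tails (`isTFull_toC`), and 𝓛_tails = 𝓣_tails makes the tails a topology.

Necessity. If C(F(-), -) is an equivalence onto sheaves, then it is faithful, which means
generation, and its values are separated, which means ampleness. The other two conditions come from
`sieve_mem_of_forall_epi`: the local closure of a submodule S of C(F(-), Y) is a sheaf, so it is
C(F(-), Z) for a subobject Z of Y. If S can only factor through epimorphisms, then Z = Y and S is
everything locally. Projectivity takes for S the image of an epimorphism. Finite presentation takes
the maps through a leg of the cocone, and the maps killed at a later stage, where exactness of
filtered colimits enters.

Sufficiency. A coproduct is the filtered colimit of its finite subcoproducts, so finite presentation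
and local fullness make any F(X) → ∐ F(d i) locally an element of the free module ⨁ A(-, d i)
(`sieve_range_freeToSigma_mem`). Hence relations in C can be tested in modules, and
`exists_extension` yields both fullness and the sheaf property. For essential surjectivity, present
a sheaf M by generators and relations, transport the presentation to C and take the cokernel K.
Projectivity lifts maps to quotients locally, so M → C(F(-), K) is injective and locally surjective,
hence an isomorphism (`exists_restrictedYoneda_iso`). -/

lemma presheaf_map_comp_apply (M : Aᵒᵖ ⥤ ModuleCat.{v} k) {X Y Z : A} (g : Z ⟶ Y) (f : Y ⟶ X)
    (x : M.obj (op X)) :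
    (M.map (g ≫ f).op).hom x = (M.map g.op).hom ((M.map f.op).hom x) := by
  rw [op_comp, M.map_comp]; rfl

lemma presheaf_map_id_apply (M : Aᵒᵖ ⥤ ModuleCat.{v} k) {X : A} (x : M.obj (op X)) :
    (M.map (𝟙 X).op).hom x = x := by
  rw [op_id, M.map_id]; rfl

lemma presheaf_hom_naturality_apply {M N : Aᵒᵖ ⥤ ModuleCat.{v} k} (φ : M ⟶ N) {X Y : A}
    (g : Y ⟶ X) (x : M.obj (op X)) :
    (φ.app (op Y)).hom ((M.map g.op).hom x) = (N.map g.op).hom ((φ.app (op X)).hom x) :=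
  congrArg (fun h => h.hom x) (φ.naturality g.op)

lemma presheaf_iso_hom_inv_apply {M N : Aᵒᵖ ⥤ ModuleCat.{v} k} (e : M ≅ N) {X : A}
    (x : M.obj (op X)) : (e.inv.app (op X)).hom ((e.hom.app (op X)).hom x) = x :=
  congrArg (fun h => h.hom x) (e.hom_inv_id_app (op X))

end Presheaf

/-! ### Local membership, closures of submodules, and sheaves. -/

section Topology

variable {k : Type w} [CommRing k] {A : Type} [Category.{v} A] [Preadditive A] [Linear k A]

/-- A family of submodules of a presheaf of `k`-modules that is stable under restriction. -/
structure SubPresheaf (M : Aᵒᵖ ⥤ ModuleCat.{v} k) where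
  /-- the submodule of `M(X)` -/
  carrier : ∀ X : A, Submodule k (M.obj (op X))
  map_mem : ∀ {Y Z : A} (g : Z ⟶ Y) {x : M.obj (op Y)}, x ∈ carrier Y →
    (M.map g.op).hom x ∈ carrier Z

namespace IsRightModule

variable {M : Aᵒᵖ ⥤ ModuleCat.{v} k} (hM : IsRightModule M)
include hM

lemma map_add_apply {X Y : A} (f g : Y ⟶ X) (x : M.obj (op X)) :
    (M.map (f + g).op).hom x = (M.map f.op).hom x + (M.map g.op).hom x := by
  rw [hM.map_add]; rfl

lemma map_smul_apply {X Y : A} (r : k) (f : Y ⟶ X) (x : M.obj (op X)) :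
    (M.map (r • f).op).hom x = r • (M.map f.op).hom x := by
  rw [hM.map_smul]; rfl

/-- Evaluation of the action of `A(Y, X)` at an element `x` of `M(X)`. -/
def eval {X : A} (x : M.obj (op X)) (Y : A) : (Y ⟶ X) →ₗ[k] M.obj (op Y) where
  toFun f := (M.map f.op).hom x
  map_add' f g := hM.map_add_apply f g x
  map_smul' r f := hM.map_smul_apply r f x

@[simp]
lemma eval_apply {X Y : A} (x : M.obj (op X)) (f : Y ⟶ X) :
    hM.eval x Y f = (M.map f.op).hom x := rfl

end IsRightModule

/-- The sieve of all morphisms along which the restriction of `x` lies in `S`. -/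
def SubPresheaf.sieve {M : Aᵒᵖ ⥤ ModuleCat.{v} k} (S : SubPresheaf M) (hM : IsRightModule M)
    {X : A} (x : M.obj (op X)) : LinearSieve k X where
  carrier Y := (S.carrier Y).comap (hM.eval x Y)
  comp_mem {Y Z} g f hf := by
    simp only [Submodule.mem_comap, IsRightModule.eval_apply] at hf ⊢
    rw [presheaf_map_comp_apply]
    exact S.map_mem g hf

lemma SubPresheaf.pullback_sieve {M : Aᵒᵖ ⥤ ModuleCat.{v} k} (S : SubPresheaf M)
    (hM : IsRightModule M) {X Y : A} (x : M.obj (op X)) (f : Y ⟶ X) :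
    (S.sieve hM x).pullback f = S.sieve hM ((M.map f.op).hom x) := by
  ext Z g
  change (M.map (g ≫ f).op).hom x ∈ S.carrier Z ↔
    (M.map g.op).hom ((M.map f.op).hom x) ∈ S.carrier Z
  rw [presheaf_map_comp_apply]

/-- The image of a morphism of presheaves. -/
def rangeSub {M N : Aᵒᵖ ⥤ ModuleCat.{v} k} (φ : M ⟶ N) : SubPresheaf N where
  carrier X := LinearMap.range (φ.app (op X)).hom
  map_mem := by
    rintro Y Z g _ ⟨x, rfl⟩
    exact ⟨(M.map g.op).hom x, presheaf_hom_naturality_apply φ g x⟩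

/-- The presheaf underlying a family of submodules stable under restriction. -/
def SubPresheaf.toPresheaf {M : Aᵒᵖ ⥤ ModuleCat.{v} k} (S : SubPresheaf M) :
    Aᵒᵖ ⥤ ModuleCat.{v} k where
  obj X := ModuleCat.of k (S.carrier X.unop)
  map {X Y} g := ModuleCat.ofHom ((M.map g).hom.restrict (p := S.carrier X.unop)
    (q := S.carrier Y.unop) fun _ hx => S.map_mem g.unop hx)
  map_id X := by
    refine ModuleCat.hom_ext (LinearMap.ext fun x => ?_)
    exact Subtype.ext (presheaf_map_id_apply M x.1)
  map_comp {X Y Z} f g := by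
    refine ModuleCat.hom_ext (LinearMap.ext fun x => ?_)
    exact Subtype.ext (presheaf_map_comp_apply M g.unop f.unop x.1)

/-- The inclusion of a subpresheaf. -/
def SubPresheaf.incl {M : Aᵒᵖ ⥤ ModuleCat.{v} k} (S : SubPresheaf M) : S.toPresheaf ⟶ M where
  app X := ModuleCat.ofHom (S.carrier X.unop).subtype
  naturality _ _ _ := rfl

lemma SubPresheaf.isRightModule {M : Aᵒᵖ ⥤ ModuleCat.{v} k} (S : SubPresheaf M)
    (hM : IsRightModule M) : IsRightModule S.toPresheaf where
  map_add {X Y} f g := by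
    ext x
    exact Subtype.ext (hM.map_add_apply f g x.1)
  map_smul {X Y} r f := by
    ext x
    exact Subtype.ext (hM.map_smul_apply r f x.1)

namespace IsTopology

variable {T : CoveringSystem k A} (hT : IsTopology T)
include hT

/-- Along every morphism of `R` the pullback of `S` is the whole representable, so glueing applies.
-/
lemma mem_of_le {X : A} {R S : LinearSieve k X} (hR : R ∈ T X) (h : R ≤ S) : S ∈ T X := by
  refine hT.glueing R S hR fun Y f hf => ?_
  have : S.pullback f = LinearSieve.whole Y := by
    ext Z g
    exact ⟨fun _ => Submodule.mem_top, fun _ => S.comp_mem g (h Y hf)⟩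
  rw [this]
  exact hT.identity Y

lemma sieve_mem_of_forall {M : Aᵒᵖ ⥤ ModuleCat.{v} k} (S : SubPresheaf M) (hM : IsRightModule M)
    {X : A} (x : M.obj (op X)) {R : LinearSieve k X} (hR : R ∈ T X)
    (h : ∀ (Y : A) (f : Y ⟶ X), f ∈ R.carrier Y → (M.map f.op).hom x ∈ S.carrier Y) :
    S.sieve hM x ∈ T X :=
  hT.mem_of_le hR fun Y f hf => h Y f hf

lemma sieve_mem_of_forall_sieve_mem {M : Aᵒᵖ ⥤ ModuleCat.{v} k} (S : SubPresheaf M)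
    (hM : IsRightModule M)
    {X : A} (x : M.obj (op X)) {R : LinearSieve k X} (hR : R ∈ T X)
    (h : ∀ (Y : A) (f : Y ⟶ X), f ∈ R.carrier Y → S.sieve hM ((M.map f.op).hom x) ∈ T Y) :
    S.sieve hM x ∈ T X :=
  hT.glueing R _ hR fun Y f hf => by
    rw [S.pullback_sieve]
    exact h Y f hf

/-- Glueing stands in for intersecting two coverings: restrict along the sieve of `x`, then along
the pulled-back sieve of `y`. -/
lemma sieve_add_mem {M : Aᵒᵖ ⥤ ModuleCat.{v} k} (S : SubPresheaf M) (hM : IsRightModule M)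
    {X : A} {x y : M.obj (op X)} (hx : S.sieve hM x ∈ T X) (hy : S.sieve hM y ∈ T X) :
    S.sieve hM (x + y) ∈ T X := by
  refine hT.sieve_mem_of_forall_sieve_mem S hM _ hx fun Y f hf => ?_
  have h := hT.pullback _ f hy
  rw [S.pullback_sieve] at h
  refine hT.sieve_mem_of_forall S hM _ h fun Z g hg => ?_
  rw [map_add, map_add]
  exact add_mem (S.map_mem g hf) hg

end IsTopology

/-- The subpresheaf of the elements that lie locally in `S`. -/
def SubPresheaf.closure {T : CoveringSystem k A} (hT : IsTopology T)
    {M : Aᵒᵖ ⥤ ModuleCat.{v} k} (S : SubPresheaf M) (hM : IsRightModule M) : SubPresheaf M where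
  carrier X :=
    { carrier := {x | S.sieve hM x ∈ T X}
      add_mem' := hT.sieve_add_mem S hM
      zero_mem' := hT.sieve_mem_of_forall S hM _ (hT.identity X) fun Y f _ => by
        rw [map_zero]; exact zero_mem _
      smul_mem' := fun r x hx => hT.sieve_mem_of_forall S hM _ hx fun Y f hf => by
        rw [map_smul]; exact Submodule.smul_mem _ r hf }
  map_mem {Y Z} g x hx := by
    have := hT.pullback _ g hx
    rwa [S.pullback_sieve] at this

lemma SubPresheaf.le_closure {T : CoveringSystem k A} (hT : IsTopology T)
    {M : Aᵒᵖ ⥤ ModuleCat.{v} k} (S : SubPresheaf M) (hM : IsRightModule M) (X : A) :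
    S.carrier X ≤ (S.closure hT hM).carrier X := fun _ hx =>
  hT.sieve_mem_of_forall S hM _ (hT.identity X) fun _ f _ => S.map_mem f hx

/-- Composition of a morphism from a sieve with a morphism of presheaves. -/
def LinearSieve.HomTo.comp {X : A} {R : LinearSieve k X} {M N : Aᵒᵖ ⥤ ModuleCat.{v} k}
    (ψ : R.HomTo M) (φ : M ⟶ N) : R.HomTo N where
  app Y := (φ.app (op Y)).hom ∘ₗ ψ.app Y
  naturality g f := by
    simp only [LinearMap.comp_apply]
    rw [ψ.naturality, presheaf_hom_naturality_apply]

/-- The uniqueness part of the sheaf property. -/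
def IsSeparated (T : CoveringSystem k A) (M : Aᵒᵖ ⥤ ModuleCat.{v} k) : Prop :=
  ∀ (X : A) (R : LinearSieve k X), R ∈ T X → ∀ x : M.obj (op X),
    (∀ (Y : A) (f : Y ⟶ X), f ∈ R.carrier Y → (M.map f.op).hom x = 0) → x = 0

lemma IsLinearSheaf.isSeparated {T : CoveringSystem k A} {M : Aᵒᵖ ⥤ ModuleCat.{v} k}
    (h : IsLinearSheaf T M) : IsSeparated T M := fun X R hR _ hx =>
  (h X R hR { app := fun _ => 0, naturality := fun _ _ => (map_zero _).symm }).unique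
    (fun Y f => (hx Y f.1 f.2).symm) (fun _ _ => (map_zero _).symm)

/-- Amalgamate in `M`. The result lies locally in the closure, and by glueing the closure is already
closed under this. -/
lemma SubPresheaf.isLinearSheaf_closure {T : CoveringSystem k A} (hT : IsTopology T)
    {M : Aᵒᵖ ⥤ ModuleCat.{v} k} (S : SubPresheaf M) (hM : IsRightModule M)
    (h : IsLinearSheaf T M) : IsLinearSheaf T (S.closure hT hM).toPresheaf := by
  intro X R hR φ
  obtain ⟨x, hx, hx'⟩ := h X R hR (φ.comp (S.closure hT hM).incl)
  refine ⟨⟨x, hT.sieve_mem_of_forall_sieve_mem S hM x hR fun Y f hf => ?_⟩, fun Y f => ?_,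
    fun y hy => ?_⟩
  · rw [← hx Y ⟨f, hf⟩]
    exact (φ.app Y ⟨f, hf⟩).2
  · exact Subtype.ext (hx Y f)
  · exact Subtype.ext (hx' y.1 fun Y f => congrArg Subtype.val (hy Y f))

lemma IsLinearSheaf.of_iso {T : CoveringSystem k A} {M N : Aᵒᵖ ⥤ ModuleCat.{v} k} (e : M ≅ N)
    (hM : IsLinearSheaf T M) : IsLinearSheaf T N := by
  intro X R hR φ
  obtain ⟨x, hx, hx'⟩ := hM X R hR (φ.comp e.inv)
  refine ⟨(e.hom.app (op X)).hom x, fun Y f => ?_, fun y hy => ?_⟩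
  · rw [← presheaf_hom_naturality_apply, ← hx]
    exact (presheaf_iso_hom_inv_apply e.symm _).symm
  · rw [← hx' ((e.inv.app (op X)).hom y) fun Y f => ?_]
    · exact (presheaf_iso_hom_inv_apply e.symm y).symm
    · rw [← presheaf_hom_naturality_apply, ← hy]
      rfl

lemma generatedTopology_isTopology (L : CoveringSystem k A) :
    IsTopology (generatedTopology L) where
  identity X _ hT _ := hT.identity X
  pullback R f hR T hT hL := hT.pullback R f (hR T hT hL)
  glueing R S hR hS T hT hL := hT.glueing R S (hR T hT hL) fun Y f hf => hS Y f hf T hT hL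

end Topology

end LinTop

end

noncomputable section

namespace LinTop

/-! ### The functor C(F(-), -) and elementwise forms of the conditions. -/

section RestrictedYoneda

variable {k : Type w} [CommRing k] {A : Type} [Category.{v} A]
  {C : Type u} [Category.{v} C]

instance forget_preservesColimitsOfShape_of_isFiltered (J : Type v) [SmallCategory J]
    [IsFiltered J] : PreservesColimitsOfShape J (forget (ModuleCat.{v} k)) :=
  inferInstanceAs (PreservesColimitsOfShape J
    (forget₂ (ModuleCat.{v} k) AddCommGrpCat.{v} ⋙ forget AddCommGrpCat.{v}))

section FilteredColimits

variable {J : Type v} [SmallCategory J] [IsFiltered J] (G : J ⥤ Aᵒᵖ ⥤ ModuleCat.{v} k) (X : A)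

lemma presheaf_colimit_exists_rep (x : (colimit G).obj (op X)) :
    ∃ (j : J) (y : (G.obj j).obj (op X)), ((colimit.ι G j).app (op X)).hom y = x :=
  Concrete.isColimit_exists_rep (G ⋙ (evaluation _ _).obj (op X))
    (isColimitOfPreserves ((evaluation _ _).obj (op X)) (colimit.isColimit G)) x

lemma presheaf_colimit_ι_eq_zero_iff {i : J} (y : (G.obj i).obj (op X)) :
    ((colimit.ι G i).app (op X)).hom y = 0 ↔
      ∃ (j : J) (a : i ⟶ j), ((G.map a).app (op X)).hom y = 0 := by
  have key := Concrete.isColimit_rep_eq_iff_exists (G ⋙ (evaluation _ _).obj (op X))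
    (isColimitOfPreserves ((evaluation _ _).obj (op X)) (colimit.isColimit G)) y
    (0 : (G.obj i).obj (op X))
  constructor
  · intro h
    obtain ⟨j, a, b, hab⟩ := key.1 (h.trans (map_zero ((colimit.ι G i).app (op X)).hom).symm)
    exact ⟨j, a, hab.trans (map_zero ((G.map b).app (op X)).hom)⟩
  · rintro ⟨j, a, ha⟩
    exact (key.2 ⟨j, a, a, ha.trans (map_zero ((G.map a).app (op X)).hom).symm⟩).trans
      (map_zero ((colimit.ι G i).app (op X)).hom)

end FilteredColimits

section ColimitMk

variable [Preadditive C] [Linear k C] (F : A ⥤ C) {J : Type v} [SmallCategory J] (D : J ⥤ C) {X : A}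

variable (k) in
/-- The element of `colim C(F(X), D_i)` represented by a morphism `F(X) ⟶ D_i`. -/
def colimitMk (i : J) (f : F.obj X ⟶ D.obj i) :
    (colimit (D ⋙ restrictedYoneda k F)).obj (op X) :=
  ((colimit.ι (D ⋙ restrictedYoneda k F) i).app (op X)).hom f

lemma post_colimitMk [HasColimit D] (i : J) (f : F.obj X ⟶ D.obj i) :
    ((colimit.post D (restrictedYoneda k F)).app (op X)).hom (colimitMk k F D i f) =
      f ≫ colimit.ι D i :=
  congrArg (fun h => (h.app (op X)).hom f) (colimit.ι_post D (restrictedYoneda k F) i)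

lemma map_colimitMk (i : J) (f : F.obj X ⟶ D.obj i) {Y : A} (g : Y ⟶ X) :
    ((colimit (D ⋙ restrictedYoneda k F)).map g.op).hom (colimitMk k F D i f) =
      colimitMk k F D i (F.map g ≫ f) :=
  (presheaf_hom_naturality_apply (colimit.ι (D ⋙ restrictedYoneda k F) i) g f).symm

variable [IsFiltered J]

lemma exists_colimitMk_eq (x : (colimit (D ⋙ restrictedYoneda k F)).obj (op X)) :
    ∃ (i : J) (f : F.obj X ⟶ D.obj i), colimitMk k F D i f = x :=
  presheaf_colimit_exists_rep _ _ x

lemma colimitMk_eq_zero_iff (i : J) (f : F.obj X ⟶ D.obj i) :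
    colimitMk k F D i f = 0 ↔ ∃ (j : J) (a : i ⟶ j), f ≫ D.map a = 0 :=
  presheaf_colimit_ι_eq_zero_iff (D ⋙ restrictedYoneda k F) X f

end ColimitMk

/-- The images under `F` of the objects of `A` separate morphisms in `C`. -/
def IsSeparatingFunctor (F : A ⥤ C) : Prop :=
  ∀ ⦃X Y : C⦄ (a b : X ⟶ Y), (∀ (Z : A) (x : F.obj Z ⟶ X), x ≫ a = x ≫ b) → a = b

variable [Preadditive A] [Linear k A]

section Preadditive

variable [Preadditive C] [Linear k C]

lemma restrictedYoneda_isRightModule (F : A ⥤ C) [F.Additive] [F.Linear k] (Y : C) :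
    IsRightModule ((restrictedYoneda k F).obj Y) where
  map_add f g := by
    refine ModuleCat.hom_ext (LinearMap.ext fun x => ?_)
    exact (congrArg (· ≫ (x : F.obj _ ⟶ Y)) F.map_add).trans (Preadditive.add_comp _ _ _ _ _ _)
  map_smul r f := by
    refine ModuleCat.hom_ext (LinearMap.ext fun x => ?_)
    exact (congrArg (· ≫ (x : F.obj _ ⟶ Y)) (F.map_smul r f)).trans (Linear.smul_comp _ _ _ _ _ _)

/-- Subpresheaves of `C(F(-), Y)`. -/
def yonedaSub (F : A ⥤ C) {Y : C} (S : ∀ X : A, Submodule k (F.obj X ⟶ Y))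
    (h : ∀ {X Z : A} (g : Z ⟶ X) {f : F.obj X ⟶ Y}, f ∈ S X → F.map g ≫ f ∈ S Z) :
    SubPresheaf ((restrictedYoneda k F).obj Y) where
  carrier := S
  map_mem := h

end Preadditive

variable [Abelian C]

lemma isTProjective_iff (T : CoveringSystem k A) (F : A ⥤ C) [Linear k C] :
    IsTProjective T F ↔ ∀ {X Y : C} (c : X ⟶ Y), Epi c → ∀ (Z : A) (f : F.obj Z ⟶ Y),
      ∃ R ∈ T Z, ∀ (W : A) (g : W ⟶ Z), g ∈ R.carrier W →
        ∃ h : F.obj W ⟶ X, h ≫ c = F.map g ≫ f := Iff.rfl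

variable [IsGrothendieckAbelian.{v} C]

/-- Maps out of a coproduct are determined by their components, and epimorphisms are detected by
cancelling zero. Ampleness thus says that every C(F(-), Y) is separated. -/
lemma isTAmple_iff (T : CoveringSystem k A) (F : A ⥤ C) :
    IsTAmple T F ↔ ∀ (Y : C) (X : A) (R : LinearSieve k X), R ∈ T X → ∀ x : F.obj X ⟶ Y,
      (∀ (Z : A) (f : Z ⟶ X), f ∈ R.carrier Z → F.map f ≫ x = 0) → x = 0 := by
  constructor
  · intro H Y X R hR x hx
    have := H X R hR
    refine (cancel_epi (Sigma.desc (fun f : (Σ Y : A, R.carrier Y) => F.map f.2.1))).1 ?_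
    refine Sigma.hom_ext _ _ fun f => ?_
    rw [Sigma.ι_desc_assoc, Sigma.ι_desc_assoc, comp_zero]
    exact hx f.1 f.2.1 f.2.2
  · intro H X R hR
    refine Preadditive.epi_of_cancel_zero _ fun {Y} x hx => ?_
    refine H Y X R hR x fun Z f hf => ?_
    have := Sigma.ι (fun f : (Σ Y : A, R.carrier Y) => F.obj f.1) ⟨Z, f, hf⟩ ≫= hx
    rwa [Sigma.ι_desc_assoc, comp_zero] at this

variable [Linear k C]

/-- Local lifting of morphisms to, and local detection of zero in, filtered colimits. -/
def HasLocalLiftsToColimits (T : CoveringSystem k A) (F : A ⥤ C) : Prop :=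
  ∀ (J : Type v) [SmallCategory J] [IsFiltered J] (D : J ⥤ C) (c : Cocone D), IsColimit c →
    ∀ X : A,
      (∀ f : F.obj X ⟶ c.pt, ∃ R ∈ T X, ∀ (Y : A) (g : Y ⟶ X), g ∈ R.carrier Y →
        ∃ (i : J) (h : F.obj Y ⟶ D.obj i), h ≫ c.ι.app i = F.map g ≫ f) ∧
      (∀ (i : J) (f : F.obj X ⟶ D.obj i), f ≫ c.ι.app i = 0 →
        ∃ R ∈ T X, ∀ (Y : A) (g : Y ⟶ X), g ∈ R.carrier Y →
          ∃ (j : J) (a : i ⟶ j), F.map g ≫ f ≫ D.map a = 0)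

/-- Filtered colimits of modules are computed on underlying sets: each element comes from some
stage, and it is zero exactly when it dies at a later one. -/
lemma isTFinitelyPresented_iff (T : CoveringSystem k A) (F : A ⥤ C) :
    IsTFinitelyPresented T F ↔ HasLocalLiftsToColimits T F := by
  constructor
  · intro H J _ _ D c hc X
    obtain ⟨h₁, h₂⟩ := H J D
    have hι (i : J) : colimit.ι D i ≫ (colimit.isoColimitCocone ⟨c, hc⟩).hom = c.ι.app i := by simp
    have hι' (i : J) : c.ι.app i ≫ (colimit.isoColimitCocone ⟨c, hc⟩).inv = colimit.ι D i :=
      colimit.isoColimitCocone_ι_inv ⟨c, hc⟩ i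
    refine ⟨fun f => ?_, fun i f hf => ?_⟩
    · obtain ⟨R, hR, h⟩ := h₁ X (f ≫ (colimit.isoColimitCocone ⟨c, hc⟩).inv)
      refine ⟨R, hR, fun Y g hg => ?_⟩
      obtain ⟨x, hx⟩ := h Y g hg
      obtain ⟨i, y, rfl⟩ := exists_colimitMk_eq _ _ x
      have hy : y ≫ colimit.ι D i = F.map g ≫ f ≫ (colimit.isoColimitCocone ⟨c, hc⟩).inv :=
        (post_colimitMk F D i y).symm.trans hx
      exact ⟨i, y, by rw [← hι, reassoc_of% hy, Iso.inv_hom_id, Category.comp_id]⟩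
    · have hf' : f ≫ colimit.ι D i = 0 := by rw [← hι', reassoc_of% hf, zero_comp]
      obtain ⟨R, hR, h⟩ := h₂ X (colimitMk k F D i f) ((post_colimitMk F D i f).trans hf')
      refine ⟨R, hR, fun Y g hg => ?_⟩
      obtain ⟨j, a, ha⟩ := (colimitMk_eq_zero_iff F D i _).1
        ((map_colimitMk F D i f g).symm.trans (h Y g hg))
      exact ⟨j, a, (Category.assoc _ _ _).symm.trans ha⟩
  · intro H J _ _ D
    have H' := H J D _ (colimit.isColimit D)
    refine ⟨fun X y => ?_, fun X x hx => ?_⟩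
    · obtain ⟨R, hR, h⟩ := (H' X).1 y
      refine ⟨R, hR, fun Y g hg => ?_⟩
      obtain ⟨i, z, hz⟩ := h Y g hg
      exact ⟨colimitMk k F D i z, (post_colimitMk F D i z).trans hz⟩
    · obtain ⟨i, f, rfl⟩ := exists_colimitMk_eq _ _ x
      obtain ⟨R, hR, h⟩ := (H' X).2 i f ((post_colimitMk F D i f).symm.trans hx)
      refine ⟨R, hR, fun Y g hg => ?_⟩
      obtain ⟨j, a, ha⟩ := h Y g hg
      rw [map_colimitMk, colimitMk_eq_zero_iff]
      exact ⟨j, a, (Category.assoc _ _ _).trans ha⟩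

end RestrictedYoneda

end LinTop

end

noncomputable section

namespace LinTop

/-! ### Necessity of the conditions. -/

section Faithful

variable {k : Type w} [CommRing k] {A : Type} [Category.{v} A]
  {C : Type u} [Category.{v} C]

lemma isSeparatingFunctor_of_faithful [Preadditive C] [Linear k C] (F : A ⥤ C)
    [(restrictedYoneda k F).Faithful] : IsSeparatingFunctor F := fun X Y a b h =>
  (restrictedYoneda k F).map_injective (by
    ext Z x
    exact h Z.unop x)

end Faithful

section Necessity

variable {k : Type w} [CommRing k] {A : Type} [Category.{v} A] [Preadditive A] [Linear k A]
  {C : Type u} [Category.{v} C]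

variable [Abelian C] [Linear k C]
  {T : CoveringSystem k A} {F : A ⥤ C}
  {e : C ⥤ Sh T} (iso : e ⋙ (sheafProperty T).ι ≅ restrictedYoneda k F)

include iso in
lemma isLinearSheaf_restrictedYoneda (Y : C) :
    IsLinearSheaf T ((restrictedYoneda k F).obj Y) :=
  (e.obj Y).property.2.of_iso (iso.app Y)

include iso in
lemma isTAmple_of_iso [IsGrothendieckAbelian.{v} C] : IsTAmple T F := by
  rw [isTAmple_iff]
  intro Y X R hR x hx
  exact (isLinearSheaf_restrictedYoneda iso Y).isSeparated X R hR x hx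

variable (hT : IsTopology T) [F.Additive] [F.Linear k] [e.IsEquivalence]

include iso hT in
/-- A subpresheaf of `C(F(-), Y)` that is contained in no `C(F(-), Z)` for a proper subobject `Z`
of `Y` covers `C(F(-), Y)` locally. -/
lemma sieve_mem_of_forall_epi {Y : C} (S : SubPresheaf ((restrictedYoneda k F).obj Y))
    (hS : ∀ (Z : C) (i : Z ⟶ Y),
      (∀ (X : A) (f : F.obj X ⟶ Y), f ∈ S.carrier X → ∃ g : F.obj X ⟶ Z, g ≫ i = f) → Epi i)
    (X : A) (y : F.obj X ⟶ Y) :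
    S.sieve (restrictedYoneda_isRightModule F Y) (X := X) y ∈ T X := by
  have : (restrictedYoneda k F).Full := Functor.Full.of_iso iso
  have : (restrictedYoneda k F).Faithful := Functor.Faithful.of_iso iso
  have hY := restrictedYoneda_isRightModule (k := k) F Y
  let I : Sh T := ⟨(S.closure hT hY).toPresheaf, (S.closure hT hY).isRightModule hY,
    S.isLinearSheaf_closure hT hY (isLinearSheaf_restrictedYoneda iso Y)⟩
  -- The closure is a sheaf, so it is represented by some `Z`; by fullness its inclusion is induced
  -- by a morphism `i`.
  let Z : C := e.objPreimage I
  let α : (restrictedYoneda k F).obj Z ≅ (S.closure hT hY).toPresheaf :=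
    (iso.app Z).symm ≪≫ (sheafProperty T).ι.mapIso (e.objObjPreimageIso I)
  let i : Z ⟶ Y := (restrictedYoneda k F).preimage (α.hom ≫ (S.closure hT hY).incl)
  have hi : (restrictedYoneda k F).map i = α.hom ≫ (S.closure hT hY).incl :=
    Functor.map_preimage _ _
  have hi' (X : A) (f : F.obj X ⟶ Z) :
      f ≫ i = ((S.closure hT hY).incl.app (op X)).hom ((α.hom.app (op X)).hom f) :=
    congrArg (fun h => (h.app (op X)).hom f) hi
  have : Mono i := by
    refine Preadditive.mono_of_cancel_zero i fun {W} f hf => ?_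
    refine isSeparatingFunctor_of_faithful (k := k) F _ _ fun X x => ?_
    rw [comp_zero]
    have h₀ : ((S.closure hT hY).incl.app (op X)).hom ((α.hom.app (op X)).hom (x ≫ f)) = 0 := by
      rw [← hi', Category.assoc, hf, comp_zero]; rfl
    have h₁ : (α.hom.app (op X)).hom (x ≫ f) = 0 := Subtype.ext h₀
    exact (presheaf_iso_hom_inv_apply α (X := X) (x ≫ f)).symm.trans (by rw [h₁, map_zero]; rfl)
  -- `S` is contained in its closure, so its elements factor through `i`.
  have : Epi i := hS Z i fun X f hf => by
    let f' : (S.closure hT hY).toPresheaf.obj (op X) := ⟨f, S.le_closure hT hY X hf⟩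
    refine ⟨(α.inv.app (op X)).hom f', ?_⟩
    refine (hi' X _).trans ?_
    rw [show (α.hom.app (op X)).hom ((α.inv.app (op X)).hom f') = f' from
      presheaf_iso_hom_inv_apply α.symm f']
    rfl
  have : IsIso i := isIso_of_mono_of_epi i
  have h : y = ((S.closure hT hY).incl.app (op X)).hom ((α.hom.app (op X)).hom (y ≫ inv i)) := by
    rw [← hi', Category.assoc, IsIso.inv_hom_id, Category.comp_id]
  have h' : y ∈ (S.closure hT hY).carrier X := by
    rw [h]
    exact ((α.hom.app (op X)).hom (y ≫ inv i)).2
  exact h'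

-- Any `i` through which all maps `x ≫ c` factor is epi: two maps that agree after `i` agree after
-- `c`, because the F(V) separate, and `c` is epi.
include iso hT in
lemma isTProjective_of_isEquivalence : IsTProjective T F := by
  have : (restrictedYoneda k F).Faithful := Functor.Faithful.of_iso iso
  rw [isTProjective_iff]
  intro X Y c _ W f
  refine ⟨_, sieve_mem_of_forall_epi iso hT (rangeSub ((restrictedYoneda k F).map c))
    (fun Z i hi => ⟨fun a b hab => ?_⟩) W f, fun V g hg => hg⟩
  rw [← cancel_epi c]
  refine isSeparatingFunctor_of_faithful (k := k) F _ _ fun V x => ?_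
  obtain ⟨g, hg⟩ := hi V (x ≫ c) ⟨x, rfl⟩
  rw [← Category.assoc, ← hg, Category.assoc, hab, ← Category.assoc, hg, Category.assoc]

section

variable {J : Type v} [SmallCategory J] [IsFiltered J] (D : J ⥤ C)

variable (k F) in
/-- The morphisms to the point of a cocone that factor through one of its legs. -/
def legSub (c : Cocone D) : SubPresheaf ((restrictedYoneda k F).obj c.pt) :=
  yonedaSub F (fun X =>
    { carrier := {f | ∃ (i : J) (h : F.obj X ⟶ D.obj i), h ≫ c.ι.app i = f}
      add_mem' := by
        rintro _ _ ⟨i, h, rfl⟩ ⟨i', h', rfl⟩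
        refine ⟨IsFiltered.max i i', h ≫ D.map (IsFiltered.leftToMax i i') +
          h' ≫ D.map (IsFiltered.rightToMax i i'), ?_⟩
        simp
      zero_mem' := ⟨IsFiltered.nonempty.some, 0, zero_comp⟩
      smul_mem' := by
        rintro r _ ⟨i, h, rfl⟩
        exact ⟨i, r • h, Linear.smul_comp _ _ _ _ _ _⟩ }) (by
    rintro X Z g _ ⟨i, h, rfl⟩
    exact ⟨i, F.map g ≫ h, Category.assoc _ _ _⟩)

variable (k F) in
/-- The morphisms to `X` whose composition with `f : X ⟶ D_i` vanishes at a later stage. -/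
def eventualKernelSub {X : C} {i : J} (f : X ⟶ D.obj i) :
    SubPresheaf ((restrictedYoneda k F).obj X) :=
  yonedaSub F (fun Z =>
    { carrier := {g | ∃ (j : J) (a : i ⟶ j), g ≫ f ≫ D.map a = 0}
      add_mem' := by
        rintro g g' ⟨j, a, h⟩ ⟨j', a', h'⟩
        -- The sum has to die along a single morphism out of `i`, so `a` and `a'` are extended until
        -- they coincide.
        obtain ⟨l, b, b', hb⟩ := IsFiltered.span a a'
        refine ⟨l, a ≫ b, ?_⟩
        rw [Preadditive.add_comp]
        nth_rw 2 [hb]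
        simp only [Functor.map_comp]
        rw [reassoc_of% h, reassoc_of% h', zero_comp, zero_comp, add_zero]
      zero_mem' := ⟨i, 𝟙 i, zero_comp⟩
      smul_mem' := by
        rintro r g ⟨j, a, h⟩
        exact ⟨j, a, by rw [Linear.smul_comp, h, smul_zero]⟩ }) (by
    rintro Z W b g ⟨j, a, h⟩
    exact ⟨j, a, by rw [Category.assoc, h, comp_zero]⟩)

end

variable [IsGrothendieckAbelian.{v} C]

include iso hT in
lemma isTFinitelyPresented_of_isEquivalence : IsTFinitelyPresented T F := by
  have : (restrictedYoneda k F).Faithful := Functor.Faithful.of_iso iso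
  have hsep := isSeparatingFunctor_of_faithful (k := k) F
  rw [isTFinitelyPresented_iff]
  intro J _ _ D c hc X
  refine ⟨fun f => ⟨_, sieve_mem_of_forall_epi iso hT (legSub k F D c)
    (fun Z i hi => ⟨fun a b hab => ?_⟩) X f, fun V g hg => hg⟩, fun i f hf => ?_⟩
  · refine hc.hom_ext fun j => hsep _ _ fun V x => ?_
    obtain ⟨g, hg⟩ := hi V (x ≫ c.ι.app j) ⟨j, x, rfl⟩
    rw [← Category.assoc, ← hg, Category.assoc, hab, ← Category.assoc, hg, Category.assoc]
  -- The sieve of the identity of F(X) consists of those `g` for which F(g) ≫ f dies at a later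
  -- stage.
  · refine ⟨_, sieve_mem_of_forall_epi iso hT (eventualKernelSub k F D f)
      (fun Z q hq => ⟨fun a b hab => ?_⟩) X (𝟙 _), fun V g hg => ?_⟩
    -- Exactness of filtered colimits: since `f` vanishes in the colimit, the colimit of the kernels
    -- of `f ≫ D.map a` maps onto the source of `f`.
    · have := IsGrothendieckAbelian.IsPresentable.injectivity₀.epi_f hc hf
      rw [← cancel_epi (IsGrothendieckAbelian.IsPresentable.injectivity₀.f f)]
      refine colimit.hom_ext fun j => hsep _ _ fun V x => ?_
      simp only [← Category.assoc]
      rw [Category.assoc x, IsGrothendieckAbelian.IsPresentable.injectivity₀.hf]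
      have hz := NatTrans.congr_app
        (kernel.condition (IsGrothendieckAbelian.IsPresentable.injectivity₀.g f)) j
      obtain ⟨g, hg⟩ := hq V (x ≫ (kernel.ι
        (IsGrothendieckAbelian.IsPresentable.injectivity₀.g f)).app j)
        ⟨j.right, j.hom, (Category.assoc _ _ _).trans ((x ≫= hz).trans comp_zero)⟩
      rw [← hg, Category.assoc, hab, Category.assoc]
    · obtain ⟨j, a, h⟩ := hg
      refine ⟨j, a, Eq.trans ?_ h⟩
      exact congrArg (· ≫ f ≫ D.map a) (Category.comp_id (F.map g)).symm

end Necessity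

end LinTop

end

noncomputable section

namespace LinTop

/-! ### Free modules and their comparison with coproducts in C. -/

section FreePresheaf

variable {k : Type w} [CommRing k] {A : Type} [Category.{v} A] [Preadditive A] [Linear k A]
  {I : Type v} (d : I → A)

variable (k) in
/-- The direct sum of the representable modules `A(-, d i)`. -/
def freePresheaf : Aᵒᵖ ⥤ ModuleCat.{v} k where
  obj X := ModuleCat.of k (Π₀ i, (X.unop ⟶ d i))
  map g := ModuleCat.ofHom (DFinsupp.mapRange.linearMap fun i => Linear.leftComp k (d i) g.unop)
  map_id X := by
    refine ModuleCat.hom_ext (LinearMap.ext fun c => DFinsupp.ext fun i => ?_)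
    exact Category.id_comp (c i)
  map_comp f g := by
    refine ModuleCat.hom_ext (LinearMap.ext fun c => DFinsupp.ext fun i => ?_)
    exact Category.assoc _ _ (c i)

open Classical in
variable (k) in
/-- The inclusion of the summand `A(X, d i)`. -/
def freeSingle (X : A) (i : I) : (X ⟶ d i) →ₗ[k] (freePresheaf k d).obj (op X) :=
  DFinsupp.lsingle (R := k) (M := fun i => X ⟶ d i) i

lemma freePresheaf_map_single {X Y : A} (f : Y ⟶ X) (i : I) (g : X ⟶ d i) :
    ((freePresheaf k d).map f.op).hom (freeSingle k d X i g) = freeSingle k d Y i (f ≫ g) := by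
  classical
  exact DFinsupp.mapRange_single (β₁ := fun i => X ⟶ d i) (β₂ := fun i => Y ⟶ d i)
    (f := fun i g => f ≫ g) (hf := fun _ => comp_zero)

lemma freePresheaf_isRightModule : IsRightModule (freePresheaf k d) where
  map_add f g := by
    refine ModuleCat.hom_ext (LinearMap.ext fun c => DFinsupp.ext fun i => ?_)
    exact Preadditive.add_comp _ _ _ _ _ ((show Π₀ i, (_ ⟶ d i) from c) i)
  map_smul r f := by
    refine ModuleCat.hom_ext (LinearMap.ext fun c => DFinsupp.ext fun i => ?_)
    exact Linear.smul_comp _ _ _ _ _ ((show Π₀ i, (_ ⟶ d i) from c) i)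

variable {d}

lemma freePresheaf_linearMap_ext {X : A} {N : Type v} [AddCommGroup N] [Module k N]
    {φ ψ : (freePresheaf k d).obj (op X) →ₗ[k] N}
    (h : ∀ i (g : X ⟶ d i), φ (freeSingle k d X i g) = ψ (freeSingle k d X i g)) : φ = ψ := by
  classical
  exact DFinsupp.lhom_ext (M := fun i => X ⟶ d i) (φ := φ) (ψ := ψ) h

variable {M N : Aᵒᵖ ⥤ ModuleCat.{v} k}

/-- The values of the morphism from a free presheaf determined by the images of the generators. -/
def combApp (hM : IsRightModule M) (x : ∀ i, M.obj (op (d i))) (X : A) :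
    (freePresheaf k d).obj (op X) →ₗ[k] M.obj (op X) :=
  open Classical in DFinsupp.lsum k fun i => hM.eval (x i) X

lemma combApp_single (hM : IsRightModule M) (x : ∀ i, M.obj (op (d i))) {X : A} (i : I)
    (g : X ⟶ d i) : combApp hM x X (freeSingle k d X i g) = (M.map g.op).hom (x i) := by
  classical
  exact DFinsupp.lsum_single k (fun i => hM.eval (x i) X) i g

/-- The morphism from a free presheaf determined by the images of the generators. -/
def comb (hM : IsRightModule M) (x : ∀ i, M.obj (op (d i))) : freePresheaf k d ⟶ M where
  app X := ModuleCat.ofHom (combApp hM x X.unop)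
  naturality X Y f := by
    refine ModuleCat.hom_ext ?_
    have : (combApp hM x Y.unop).comp ((freePresheaf k d).map f).hom =
        (M.map f).hom.comp (combApp hM x X.unop) := by
      refine freePresheaf_linearMap_ext fun i g => ?_
      rw [LinearMap.comp_apply, LinearMap.comp_apply, combApp_single]
      exact (congrArg _ (freePresheaf_map_single d f.unop i g)).trans
        ((combApp_single hM x i _).trans (presheaf_map_comp_apply M f.unop g (x i)))
    exact this

lemma comb_single (hM : IsRightModule M) (x : ∀ i, M.obj (op (d i))) {X : A} (i : I)
    (g : X ⟶ d i) :
    ((comb hM x).app (op X)).hom (freeSingle k d X i g) = (M.map g.op).hom (x i) :=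
  combApp_single hM x i g

lemma comb_comp (hM : IsRightModule M) (hN : IsRightModule N) (x : ∀ i, M.obj (op (d i)))
    (θ : M ⟶ N) : comb hM x ≫ θ = comb hN fun i => (θ.app (op (d i))).hom (x i) := by
  ext X : 2
  refine ModuleCat.hom_ext (freePresheaf_linearMap_ext (X := X.unop) fun i g => ?_)
  refine Eq.trans ?_ (comb_single hN _ i g).symm
  rw [← presheaf_hom_naturality_apply, ← comb_single hM x i g]
  rfl

lemma comb_comp_apply (hM : IsRightModule M) (hN : IsRightModule N) (x : ∀ i, M.obj (op (d i)))
    (θ : M ⟶ N) {X : A} (c : (freePresheaf k d).obj (op X)) :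
    (θ.app (op X)).hom (((comb hM x).app (op X)).hom c) =
      ((comb hN fun i => (θ.app (op (d i))).hom (x i)).app (op X)).hom c := by
  rw [← comb_comp hM hN]; rfl

lemma comb_eq_zero (hM : IsRightModule M) {x : ∀ i, M.obj (op (d i))} (hx : ∀ i, x i = 0) :
    comb hM x = 0 := by
  ext X : 2
  refine ModuleCat.hom_ext (freePresheaf_linearMap_ext (X := X.unop) fun i g => ?_)
  refine (comb_single hM _ i g).trans ?_
  rw [hx, map_zero]
  rfl

variable {C : Type u} [Category.{v} C] [Preadditive C] [Linear k C]
  (F : A ⥤ C) [F.Additive] [F.Linear k] (d) [HasCoproduct fun i => F.obj (d i)]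

variable (k) in
/-- The canonical morphism `⨁ A(-, d i) ⟶ C(F(-), ∐ F(d i))`. -/
def freeToSigma : freePresheaf k d ⟶
    (restrictedYoneda k F).obj (∐ fun i => F.obj (d i)) :=
  comb (restrictedYoneda_isRightModule F _) fun i => Sigma.ι (fun i => F.obj (d i)) i

lemma freeToSigma_single {X : A} (i : I) (g : X ⟶ d i) :
    ((freeToSigma k d F).app (op X)).hom (freeSingle k d X i g) =
      F.map g ≫ Sigma.ι (fun i => F.obj (d i)) i :=
  comb_single _ _ i g

lemma freeToSigma_desc {X : A} {Y : C} (x : ∀ i, F.obj (d i) ⟶ Y)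
    (c : (freePresheaf k d).obj (op X)) :
    (show F.obj X ⟶ _ from ((freeToSigma k d F).app (op X)).hom c) ≫ Sigma.desc x =
      ((comb (restrictedYoneda_isRightModule F Y) (d := d) x).app (op X)).hom c := by
  refine (comb_comp_apply (restrictedYoneda_isRightModule F _)
    (restrictedYoneda_isRightModule F Y) (fun i => Sigma.ι (fun i => F.obj (d i)) i)
    ((restrictedYoneda k F).map (Sigma.desc x)) c).trans ?_
  have h : (fun i => (((restrictedYoneda k F).map (Sigma.desc x)).app (op (d i))).hom
      (Sigma.ι (fun i => F.obj (d i)) i)) = x := funext fun i => Sigma.ι_desc x i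
  rw [h]

/-- Projecting to the `i`-th summand recovers F of the `i`-th coefficient, and `F` is faithful. -/
lemma freeToSigma_injective [F.Faithful] (X : A) :
    Function.Injective ((freeToSigma k d F).app (op X)).hom := by
  classical
  rw [← LinearMap.ker_eq_bot, LinearMap.ker_eq_bot']
  intro c hc
  have key (i : I) : (F.mapLinearMap k).comp (DFinsupp.lapply (M := fun i => X ⟶ d i) i) =
      (Linear.rightComp k (F.obj X) (Sigma.π (fun i => F.obj (d i)) i)).comp
        ((freeToSigma k d F).app (op X)).hom := by
    refine freePresheaf_linearMap_ext (d := d) fun j g => ?_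
    refine Eq.trans ?_ (congrArg (fun h => h ≫ Sigma.π (fun i => F.obj (d i)) i)
      (freeToSigma_single d F j g)).symm
    rw [Category.assoc]
    by_cases h : j = i
    · subst h
      rw [Sigma.ι_π_eq_id, Category.comp_id]
      exact congrArg F.map (DFinsupp.single_eq_same (β := fun i => X ⟶ d i))
    · rw [Sigma.ι_π_of_ne _ h, comp_zero]
      exact (congrArg F.map (DFinsupp.single_eq_of_ne (β := fun i => X ⟶ d i) (Ne.symm h))).trans
        (F.map_zero _ _)
  refine DFinsupp.ext fun i => F.map_injective ?_
  refine (LinearMap.congr_fun (key i) c).trans ?_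
  exact (congrArg (Linear.rightComp k (F.obj X) (Sigma.π (fun i => F.obj (d i)) i)) hc).trans
    ((map_zero _).trans (F.map_zero _ _).symm)

end FreePresheaf

end LinTop

end

noncomputable section

namespace LinTop

/-! ### Full faithfulness and the sheaf property. -/

section Sufficiency

variable {k : Type w} [CommRing k] {A : Type} [Category.{v} A] [Preadditive A] [Linear k A]
  {C : Type u} [Category.{v} C]

/-- Every morphism `F(X) ⟶ F(Y)` lies locally in the image of `F`. -/
def IsTFull (T : CoveringSystem k A) (F : A ⥤ C) : Prop :=
  ∀ {X Y : A} (h : F.obj X ⟶ F.obj Y), ∃ R ∈ T X, ∀ (Z : A) (g : Z ⟶ X), g ∈ R.carrier Z →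
    ∃ g' : Z ⟶ Y, F.map g' = F.map g ≫ h

lemma restrictedYoneda_faithful (k : Type w) [CommRing k] {A : Type} [Category.{v} A]
    [Preadditive C] [Linear k C] (F : A ⥤ C) (hsep : IsSeparatingFunctor F) :
    (restrictedYoneda k F).Faithful where
  map_injective h := hsep _ _ fun Z x => congrArg (fun φ => (φ.app (op Z)).hom x) h

variable [Abelian C] [IsGrothendieckAbelian.{v} C]

section SigmaDesc

variable {k : Type w} [CommRing k] {A : Type} [Category.{v} A] [Linear k C] (F : A ⥤ C)

variable (k) in
/-- The canonical morphism `∐_{x ∈ M} F(dom x) ⟶ X` induced by `M ⟶ C(F(-), X)`. -/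
def sigmaDesc {M : Aᵒᵖ ⥤ ModuleCat.{v} k} {X : C} (θ : M ⟶ (restrictedYoneda k F).obj X) :
    (∐ fun x : (Σ Z : A, M.obj (op Z)) => F.obj x.1) ⟶ X :=
  Sigma.desc fun x => (θ.app (op x.1)).hom x.2

lemma ι_sigmaDesc {M : Aᵒᵖ ⥤ ModuleCat.{v} k} {X : C} (θ : M ⟶ (restrictedYoneda k F).obj X)
    {Z : A} (x : M.obj (op Z)) :
    Sigma.ι (fun x : (Σ Z : A, M.obj (op Z)) => F.obj x.1) ⟨Z, x⟩ ≫ sigmaDesc k F θ =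
      (θ.app (op Z)).hom x :=
  Sigma.ι_desc _ _

lemma epi_sigmaDesc_id (hsep : IsSeparatingFunctor F) (X : C) :
    Epi (sigmaDesc k F (𝟙 ((restrictedYoneda k F).obj X))) where
  left_cancellation a b h := hsep _ _ fun Z x => by
    have := Sigma.ι (fun x : (Σ Z : A, ((restrictedYoneda k F).obj X).obj (op Z)) => F.obj x.1)
      ⟨Z, x⟩ ≫= h
    rw [← Category.assoc, ← Category.assoc] at this
    have hx : Sigma.ι (fun x : (Σ Z : A, ((restrictedYoneda k F).obj X).obj (op Z)) => F.obj x.1)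
      ⟨Z, x⟩ ≫ sigmaDesc k F (𝟙 ((restrictedYoneda k F).obj X)) = x := ι_sigmaDesc F (𝟙 _) _
    exact (congrArg (· ≫ a) hx.symm).trans (this.trans (congrArg (· ≫ b) hx))

end SigmaDesc

variable [Linear k C]

section LocalLifts

variable {T : CoveringSystem k A} (hT : IsTopology T) (F : A ⥤ C) [F.Additive] [F.Linear k]
  (hfull : IsTFull T F) (hfp : HasLocalLiftsToColimits T F) {I : Type v} (d : I → A)

include hT hfull hfp in
/-- Morphisms `F(X) ⟶ ∐ F(d i)` are locally finite sums of morphisms in the image of `F`. -/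
lemma sieve_range_freeToSigma_mem {X : A} (t : F.obj X ⟶ ∐ fun i => F.obj (d i)) :
    (rangeSub (freeToSigma k d F)).sieve (restrictedYoneda_isRightModule F _) (X := X) t ∈ T X := by
  classical
  -- The coproduct is the filtered colimit of its finite subcoproducts, so `t` locally factors
  -- through one of them.
  obtain ⟨R, hR, h⟩ := (hfp _ _ _ (CoproductsFromFiniteFiltered.isColimitFiniteSubproductsCocone
    (fun i => F.obj (d i))) X).1 t
  refine hT.sieve_mem_of_forall_sieve_mem _ _ _ hR fun Y f hf => ?_
  obtain ⟨S, (h' : F.obj Y ⟶ ∐ fun s : S => F.obj (d s.1.as)), hh⟩ := h Y f hf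
  replace hh : h' ≫ Sigma.desc (fun s : S => Sigma.ι (fun i => F.obj (d i)) s.1.as) =
    F.map f ≫ t := hh
  have hsum : F.map f ≫ t = ∑ s : S, (h' ≫ Sigma.π (fun s : S => F.obj (d s.1.as)) s) ≫
      Sigma.ι (fun i => F.obj (d i)) s.1.as := by
    have hid : Sigma.desc (fun s : S => Sigma.ι (fun i => F.obj (d i)) s.1.as) =
        ∑ s : S, Sigma.π (fun s : S => F.obj (d s.1.as)) s ≫
          Sigma.ι (fun i => F.obj (d i)) s.1.as := by
      refine Sigma.hom_ext _ _ fun s => ?_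
      rw [Sigma.ι_desc, Preadditive.comp_sum, Finset.sum_eq_single s]
      · rw [← Category.assoc, Sigma.ι_π_eq_id, Category.id_comp]
      · intro b _ hb
        rw [← Category.assoc, Sigma.ι_π_of_ne _ hb.symm, zero_comp]
      · simp
    rw [← hh, hid, Preadditive.comp_sum]
    exact Finset.sum_congr rfl fun s _ => (Category.assoc _ _ _).symm
  -- The closure is a submodule, so the summands can be treated one at a time; each is locally in
  -- the image of `F` by local fullness.
  have hmem : F.map f ≫ t ∈ ((rangeSub (freeToSigma k d F)).closure hT
      (restrictedYoneda_isRightModule F _)).carrier Y := by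
    rw [hsum]
    refine Submodule.sum_mem _ fun s _ => ?_
    obtain ⟨R', hR', h''⟩ := hfull (h' ≫ Sigma.π (fun s : S => F.obj (d s.1.as)) s)
    refine hT.sieve_mem_of_forall _ _ _ hR' fun Z g hg => ?_
    obtain ⟨g', hg'⟩ := h'' Z g hg
    refine ⟨freeSingle k d Z s.1.as g', (freeToSigma_single d F s.1.as g').trans ?_⟩
    rw [hg', Category.assoc]
    rfl
  exact hmem

variable (hproj : IsTProjective T F)

include hT hfull hfp hproj in
/-- Morphisms from `F(X)` to a quotient of `∐ F(d i)` lift locally to finite sums of morphisms in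
the image of `F`. -/
lemma sieve_range_freeToSigma_comp_mem {X : A} {Y : C} (p : (∐ fun i => F.obj (d i)) ⟶ Y) [Epi p]
    (t : F.obj X ⟶ Y) :
    (rangeSub (freeToSigma k d F ≫ (restrictedYoneda k F).map p)).sieve
      (restrictedYoneda_isRightModule F _) (X := X) t ∈ T X := by
  obtain ⟨R, hR, h⟩ := hproj p inferInstance X t
  refine hT.sieve_mem_of_forall_sieve_mem _ _ _ hR fun Z g hg => ?_
  obtain ⟨x, hx⟩ := h Z g hg
  refine hT.sieve_mem_of_forall _ _ _ (sieve_range_freeToSigma_mem hT F hfull hfp d (X := Z) x)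
    fun W f hf => ?_
  obtain ⟨c, hc⟩ := hf
  refine ⟨c, ?_⟩
  rw [← hx, ← presheaf_hom_naturality_apply]
  exact congrArg (((restrictedYoneda k F).map p).app (op W)).hom hc

end LocalLifts

section Extension

variable {T : CoveringSystem k A} (hT : IsTopology T) (F : A ⥤ C) [F.Additive] [F.Linear k]
  (hfull : IsTFull T F) (hsep : IsSeparatingFunctor F) (hample : IsTAmple T F)
  (hfp : HasLocalLiftsToColimits T F)

lemma freeToSigma_sigmaDesc {M : Aᵒᵖ ⥤ ModuleCat.{v} k} (hM : IsRightModule M) {X : C}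
    (θ : M ⟶ (restrictedYoneda k F).obj X) {Z : A}
    (c : (freePresheaf k (fun x : (Σ Z : A, M.obj (op Z)) => x.1)).obj (op Z)) :
    (show F.obj Z ⟶ _ from ((freeToSigma k _ F).app (op Z)).hom c) ≫ sigmaDesc k F θ =
      (θ.app (op Z)).hom (((comb hM fun x : (Σ Z : A, M.obj (op Z)) => x.2).app (op Z)).hom c) :=
  (freeToSigma_desc _ F _ c).trans
    (comb_comp_apply hM (restrictedYoneda_isRightModule F X) _ θ c).symm

include hT hfull hsep hample hfp in
/-- A morphism `M ⟶ C(F(-), Y)` extends along `M ⟶ C(F(-), X)` if the latter is injective and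
`M` covers `X`. -/
lemma exists_extension {M : Aᵒᵖ ⥤ ModuleCat.{v} k} (hM : IsRightModule M) {X Y : C}
    (θ : M ⟶ (restrictedYoneda k F).obj X)
    (hθ : ∀ Z : A, Function.Injective (θ.app (op Z)).hom)
    [Epi (sigmaDesc k F θ)] (φ : M ⟶ (restrictedYoneda k F).obj Y) :
    ∃ f : X ⟶ Y, ∀ (Z : A) (x : M.obj (op Z)),
      (show F.obj Z ⟶ X from (θ.app (op Z)).hom x) ≫ f = (φ.app (op Z)).hom x := by
  -- It suffices that the map to `Y` kills the kernel of the epimorphism to `X`. By separation and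
  -- ampleness this is tested locally on maps from F(Z), where the map is a finite sum coming from
  -- the free module.
  have hker : kernel.ι (sigmaDesc k F θ) ≫ sigmaDesc k F φ = 0 := by
    refine hsep _ _ fun Z z => ?_
    rw [comp_zero]
    refine (isTAmple_iff T F).1 hample Y Z _ (sieve_range_freeToSigma_mem hT F hfull hfp _
      (z ≫ kernel.ι (sigmaDesc k F θ))) _ fun W g hg => ?_
    obtain ⟨c, hc⟩ := hg
    have hc' : (show F.obj W ⟶ _ from ((freeToSigma k _ F).app (op W)).hom c) =
      F.map g ≫ z ≫ kernel.ι (sigmaDesc k F θ) := hc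
    have h₁ := freeToSigma_sigmaDesc F hM θ c
    have h₂ := freeToSigma_sigmaDesc F hM φ c
    rw [hc', Category.assoc, Category.assoc, kernel.condition, comp_zero, comp_zero] at h₁
    -- The combination of elements of `M` is zero in `X`, hence zero in `M` by injectivity of `θ`,
    -- hence killed by `φ`.
    have h₃ := hθ W (h₁.symm.trans (map_zero (θ.app (op W)).hom).symm)
    rw [h₃, map_zero, hc', Category.assoc, Category.assoc] at h₂
    exact h₂
  refine ⟨Abelian.epiDesc (sigmaDesc k F θ) (sigmaDesc k F φ) hker, fun Z x => ?_⟩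
  have h := Sigma.ι (fun x : (Σ Z : A, M.obj (op Z)) => F.obj x.1) ⟨Z, x⟩ ≫=
    Abelian.comp_epiDesc (sigmaDesc k F θ) (sigmaDesc k F φ) hker
  rw [← Category.assoc] at h
  exact (congrArg (· ≫ _) (ι_sigmaDesc F θ x).symm).trans (h.trans (ι_sigmaDesc F φ x))

-- The case of `exists_extension` where `θ` is the identity.
include hT hfull hsep hample hfp in
lemma restrictedYoneda_full : (restrictedYoneda k F).Full where
  map_surjective {X Y} φ := by
    have := epi_sigmaDesc_id (k := k) F hsep X
    obtain ⟨f, hf⟩ := exists_extension hT F hfull hsep hample hfp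
      (restrictedYoneda_isRightModule F X) (𝟙 _) (fun _ => Function.injective_id) φ
    refine ⟨f, ?_⟩
    ext Z x
    exact hf Z.unop x

/-- The presheaf underlying a subfunctor of a representable module. -/
def LinearSieve.toPresheaf {X : A} (R : LinearSieve k X) : Aᵒᵖ ⥤ ModuleCat.{v} k where
  obj Y := ModuleCat.of k (R.carrier Y.unop)
  map {Y Z} g := ModuleCat.ofHom ((Linear.leftComp k X g.unop).restrict
    (p := R.carrier Y.unop) (q := R.carrier Z.unop) fun _ hf => R.comp_mem g.unop hf)
  map_id _ := ModuleCat.hom_ext (LinearMap.ext fun f => Subtype.ext (Category.id_comp f.1))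
  map_comp g h := ModuleCat.hom_ext (LinearMap.ext fun f =>
    Subtype.ext (Category.assoc h.unop g.unop f.1))

lemma LinearSieve.toPresheaf_isRightModule {X : A} (R : LinearSieve k X) :
    IsRightModule R.toPresheaf where
  map_add f g := ModuleCat.hom_ext (LinearMap.ext fun x =>
    Subtype.ext (Preadditive.add_comp _ _ _ f g x.1))
  map_smul r f := ModuleCat.hom_ext (LinearMap.ext fun x =>
    Subtype.ext (Linear.smul_comp _ _ _ r f x.1))

/-- The inclusion `R ⊆ A(-, X)` followed by the action of `F`. -/
def LinearSieve.toRestrictedYoneda {X : A} (R : LinearSieve k X) :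
    R.toPresheaf ⟶ (restrictedYoneda k F).obj (F.obj X) where
  app Y := ModuleCat.ofHom ((F.mapLinearMap k).comp (R.carrier Y.unop).subtype)
  naturality _ _ g := ModuleCat.hom_ext (LinearMap.ext fun f => F.map_comp g.unop f.1)

/-- A morphism `R ⟶ M` as a morphism of presheaves. -/
def LinearSieve.HomTo.toHom {X : A} {R : LinearSieve k X} {M : Aᵒᵖ ⥤ ModuleCat.{v} k}
    (φ : R.HomTo M) : R.toPresheaf ⟶ M where
  app Y := ModuleCat.ofHom (φ.app Y.unop)
  naturality _ _ g := ModuleCat.hom_ext (LinearMap.ext fun f => φ.naturality g.unop f)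

-- The case of `exists_extension` where `θ` is the inclusion of a covering: ampleness is exactly the
-- required epimorphism, and it also gives uniqueness.
include hT hfull hsep hample hfp in
lemma restrictedYoneda_isLinearSheaf [F.Faithful] (Y : C) :
    IsLinearSheaf T ((restrictedYoneda k F).obj Y) := by
  intro X R hR φ
  have : Epi (sigmaDesc k F (R.toRestrictedYoneda F)) := hample X R hR
  obtain ⟨f, hf⟩ := exists_extension hT F hfull hsep hample hfp R.toPresheaf_isRightModule
    (R.toRestrictedYoneda F) (fun Z a b h => Subtype.ext (F.map_injective h)) φ.toHom
  refine ⟨f, fun Z g => (hf Z g).symm, fun f' hf' => ?_⟩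
  let f₁ : F.obj X ⟶ Y := f'
  have h : f₁ - f = 0 := (isTAmple_iff T F).1 hample Y X R hR _ fun Z g hg => by
    rw [Preadditive.comp_sub, sub_eq_zero]
    exact (hf' Z ⟨g, hg⟩).symm.trans (hf Z ⟨g, hg⟩).symm
  exact sub_eq_zero.1 h

end Extension

end Sufficiency

end LinTop

end

noncomputable section

namespace LinTop

/-! ### Essential surjectivity: recovering a sheaf from its generators and relations. -/

section Factorization

variable {k : Type w} [CommRing k] {A : Type} [Category.{v} A]

lemma exists_comp_eq_of_surjective {L M N : Aᵒᵖ ⥤ ModuleCat.{v} k} (β : L ⟶ M) (γ : L ⟶ N)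
    (hβ : ∀ X : A, Function.Surjective (β.app (op X)).hom)
    (h : ∀ (X : A) (c : L.obj (op X)), (β.app (op X)).hom c = 0 → (γ.app (op X)).hom c = 0) :
    ∃ η : M ⟶ N, β ≫ η = γ := by
  have : ∀ X, Epi (β.app X) := fun X => (ModuleCat.epi_iff_surjective _).2 (hβ X.unop)
  have : Epi β := NatTrans.epi_of_epi_app β
  refine ⟨Abelian.epiDesc β γ ?_, Abelian.comp_epiDesc β γ _⟩
  ext X c
  exact h X.unop _ (congrArg (fun φ => (φ.app X).hom c) (kernel.condition β))

end Factorization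

section EssentialImage

variable {k : Type w} [CommRing k] {A : Type} [Category.{v} A] [Preadditive A] [Linear k A]

/-- Local preimages of `y` are unique by injectivity, so they form a morphism from a covering; it
amalgamates in `M`, and separatedness of `N` identifies the image with `y`. -/
lemma surjective_of_isLinearSheaf {T : CoveringSystem k A} {M N : Aᵒᵖ ⥤ ModuleCat.{v} k}
    (hM : IsLinearSheaf T M) (hN : IsRightModule N) (hN' : IsSeparated T N) (η : M ⟶ N)
    (hη : ∀ X : A, Function.Injective (η.app (op X)).hom)
    (h : ∀ (X : A) (y : N.obj (op X)), (rangeSub η).sieve hN y ∈ T X) (X : A) :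
    Function.Surjective (η.app (op X)).hom := by
  intro y
  let φ (Y : A) : ((rangeSub η).sieve hN y).carrier Y →ₗ[k] M.obj (op Y) :=
    (LinearEquiv.ofInjective (η.app (op Y)).hom (hη Y)).symm.toLinearMap ∘ₗ
      (hN.eval y Y).restrict (p := ((rangeSub η).sieve hN y).carrier Y)
        (q := LinearMap.range (η.app (op Y)).hom) fun _ hf => hf
  have hφ (Y : A) (f : ((rangeSub η).sieve hN y).carrier Y) :
      (η.app (op Y)).hom (φ Y f) = (N.map f.1.op).hom y :=
    congrArg Subtype.val ((LinearEquiv.ofInjective (η.app (op Y)).hom (hη Y)).apply_symm_apply _)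
  obtain ⟨x, hx, -⟩ := hM X _ (h X y)
    { app := φ
      naturality := fun {Y Z} g f => hη Z (by
        rw [hφ, presheaf_hom_naturality_apply, hφ, ← presheaf_map_comp_apply]) }
  refine ⟨x, sub_eq_zero.1 (hN' X _ (h X y) _ fun Y f hf => ?_)⟩
  rw [map_sub, sub_eq_zero, ← presheaf_hom_naturality_apply, ← hφ Y ⟨f, hf⟩]
  exact congrArg _ (hx Y ⟨f, hf⟩).symm

variable {C : Type u} [Category.{v} C] [Abelian C] [IsGrothendieckAbelian.{v} C] [Linear k C]
  (F : A ⥤ C) [F.Additive] [F.Linear k]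

section Localization

variable {M : Aᵒᵖ ⥤ ModuleCat.{v} k} (hM : IsRightModule M)

/-- The canonical presentation of `M` by a free presheaf on its elements. -/
def tautological : freePresheaf k (fun x : (Σ Z : A, M.obj (op Z)) => x.1) ⟶ M :=
  comb hM fun x => x.2

lemma tautological_single {Z W : A} (x : M.obj (op Z)) (g : W ⟶ Z) :
    ((tautological hM).app (op W)).hom
      (freeSingle k (fun x : (Σ Z : A, M.obj (op Z)) => x.1) W ⟨Z, x⟩ g) = (M.map g.op).hom x :=
  comb_single (d := fun x : (Σ Z : A, M.obj (op Z)) => x.1) hM (fun x => x.2) ⟨Z, x⟩ g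

/-- The index set of the relations between the elements of `M`. -/
abbrev Relation := Σ Z : A, LinearMap.ker ((tautological hM).app (op Z)).hom

/-- The morphism between coproducts of objects `F(Z)` given by the relations between the elements
of `M`. -/
def relationMap : (∐ fun j : Relation hM => F.obj j.1) ⟶
    ∐ fun x : (Σ Z : A, M.obj (op Z)) => F.obj x.1 :=
  Sigma.desc fun j => ((freeToSigma k _ F).app (op j.1)).hom j.2.1

/-- The canonical morphism from the free presheaf on the elements of `M` to the presheaf
represented by the cokernel of the relations. -/
def freeToCokernel : freePresheaf k (fun x : (Σ Z : A, M.obj (op Z)) => x.1) ⟶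
    (restrictedYoneda k F).obj (cokernel (relationMap F hM)) :=
  freeToSigma k _ F ≫ (restrictedYoneda k F).map (cokernel.π (relationMap F hM))

lemma ι_relationMap (j : Relation hM) :
    Sigma.ι (fun j : Relation hM => F.obj j.1) j ≫ relationMap F hM =
      ((freeToSigma k _ F).app (op j.1)).hom j.2.1 :=
  Sigma.ι_desc (C := C) _ j

/-- Each relation becomes zero in the cokernel, so the map from the free module descends to its
quotient `M`. -/
lemma exists_unit : ∃ η : M ⟶ (restrictedYoneda k F).obj (cokernel (relationMap F hM)),
    tautological hM ≫ η = freeToCokernel F hM := by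
  refine exists_comp_eq_of_surjective _ _ (fun Z x => ?_) fun Z c hc => ?_
  · exact ⟨freeSingle k (fun x : (Σ Z : A, M.obj (op Z)) => x.1) Z ⟨Z, x⟩ (𝟙 Z),
      (tautological_single hM x _).trans (presheaf_map_id_apply M x)⟩
  · have h := Sigma.ι (fun j : Relation hM => F.obj j.1) ⟨Z, c, hc⟩ ≫=
      cokernel.condition (relationMap F hM)
    rw [← Category.assoc, comp_zero] at h
    exact (congrArg (· ≫ cokernel.π (relationMap F hM))
      (ι_relationMap F hM ⟨Z, c, hc⟩).symm).trans h

variable {T : CoveringSystem k A} (hT : IsTopology T) (hfull : IsTFull T F)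
  (hproj : IsTProjective T F) (hfp : HasLocalLiftsToColimits T F)

lemma tautological_eq_zero [F.Faithful] {W : A}
    (c : (freePresheaf k (fun j : Relation hM => j.1)).obj (op W))
    (c₀ : (freePresheaf k (fun x : (Σ Z : A, M.obj (op Z)) => x.1)).obj (op W))
    (h : (show F.obj W ⟶ _ from ((freeToSigma k _ F).app (op W)).hom c) ≫ relationMap F hM =
      ((freeToSigma k _ F).app (op W)).hom c₀) :
    ((tautological hM).app (op W)).hom c₀ = 0 := by
  -- `κ` is `relationMap` at the level of free modules. Injectivity of `freeToSigma` turns the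
  -- equation in C into `κ c = c₀`, and `κ` lands in the relations.
  let κ : freePresheaf k (fun j : Relation hM => j.1) ⟶
      freePresheaf k (fun x : (Σ Z : A, M.obj (op Z)) => x.1) :=
    comb (freePresheaf_isRightModule _) fun j => j.2.1
  have h₁ : (κ.app (op W)).hom c = c₀ := by
    refine freeToSigma_injective _ F W (Eq.trans ?_ h)
    refine Eq.trans ?_ (freeToSigma_desc (k := k) (fun j : Relation hM => j.1) F
      (fun j => ((freeToSigma k _ F).app (op j.1)).hom j.2.1) c).symm
    exact comb_comp_apply (freePresheaf_isRightModule _) (restrictedYoneda_isRightModule F _)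
      (fun j : Relation hM => j.2.1) (freeToSigma k _ F) c
  have h₂ : κ ≫ tautological hM = 0 :=
    (comb_comp (freePresheaf_isRightModule _) hM (fun j : Relation hM => j.2.1) _).trans
      (comb_eq_zero hM fun j : Relation hM => j.2.2)
  rw [← h₁]
  exact congrArg (fun φ => (φ.app (op W)).hom c) h₂

variable (k M) in
/-- The inclusion of the summand `F(Z)` that belongs to the element `x ∈ M(Z)`. -/
def elementι {Z : A} (x : M.obj (op Z)) :
    F.obj Z ⟶ ∐ fun x : (Σ Z : A, M.obj (op Z)) => F.obj x.1 :=
  Sigma.ι (fun x : (Σ Z : A, M.obj (op Z)) => F.obj x.1) ⟨Z, x⟩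

lemma freeToSigma_single_element {Z W : A} (x : M.obj (op Z)) (g : W ⟶ Z) :
    ((freeToSigma k (fun x : (Σ Z : A, M.obj (op Z)) => x.1) F).app (op W)).hom
      (freeSingle k (fun x : (Σ Z : A, M.obj (op Z)) => x.1) W ⟨Z, x⟩ g) =
        F.map g ≫ elementι k F M x :=
  freeToSigma_single (fun x : (Σ Z : A, M.obj (op Z)) => x.1) F ⟨Z, x⟩ g

lemma elementι_comp_cokernel_π {η : M ⟶ (restrictedYoneda k F).obj (cokernel (relationMap F hM))}
    (hη : tautological hM ≫ η = freeToCokernel F hM) {X : A} (x : M.obj (op X)) :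
    elementι k F M x ≫ cokernel.π (relationMap F hM) = (η.app (op X)).hom x := by
  have h₁ := congrArg (fun φ => (φ.app (op X)).hom
    (freeSingle k (fun x : (Σ Z : A, M.obj (op Z)) => x.1) X ⟨X, x⟩ (𝟙 X))) hη
  have h₂ : ((tautological hM).app (op X)).hom
      (freeSingle k (fun x : (Σ Z : A, M.obj (op Z)) => x.1) X ⟨X, x⟩ (𝟙 X)) = x := by
    rw [tautological_single, presheaf_map_id_apply]
  have h₃ : F.map (𝟙 X) ≫ elementι k F M x = elementι k F M x := by
    rw [F.map_id, Category.id_comp]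
  exact (congrArg (· ≫ cokernel.π (relationMap F hM))
    ((freeToSigma_single_element F x (𝟙 X)).trans h₃).symm).trans
      (h₁.symm.trans (congrArg (η.app (op X)).hom h₂))

include hT hfull hproj hfp in
lemma unit_injective [F.Faithful] (hM' : IsSeparated T M)
    (η : M ⟶ (restrictedYoneda k F).obj (cokernel (relationMap F hM)))
    (hη : tautological hM ≫ η = freeToCokernel F hM) (X : A) :
    Function.Injective (η.app (op X)).hom := by
  rw [← LinearMap.ker_eq_bot, LinearMap.ker_eq_bot']
  intro x hx
  have hzero : elementι k F M x ≫ cokernel.π (relationMap F hM) = 0 :=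
    (elementι_comp_cokernel_π F hM hη x).trans hx
  -- The image is the kernel of the cokernel. Its epimorphism from the coproduct over the relations
  -- lets `s` lift locally to the free module on them.
  let s : F.obj X ⟶ Abelian.image (relationMap F hM) :=
    kernel.lift (cokernel.π (relationMap F hM)) (elementι k F M x) hzero
  have hs : s ≫ Abelian.image.ι (relationMap F hM) = elementι k F M x := kernel.lift_ι _ _ _
  refine hM' X _ (sieve_range_freeToSigma_comp_mem hT F hfull hfp
    (fun j : Relation hM => j.1) hproj (Abelian.factorThruImage (relationMap F hM)) s) x
    fun W g hg => ?_
  obtain ⟨c, hc⟩ := hg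
  let c' : F.obj W ⟶ ∐ fun j : Relation hM => F.obj j.1 :=
    ((freeToSigma k (fun j : Relation hM => j.1) F).app (op W)).hom c
  have hc' : c' ≫ Abelian.factorThruImage (relationMap F hM) = F.map g ≫ s := hc
  have h : c' ≫ relationMap F hM = F.map g ≫ elementι k F M x := by
    rw [← hs, ← reassoc_of% hc', Abelian.image.fac]
  exact (tautological_single hM x g).symm.trans
    (tautological_eq_zero F hM c _ (h.trans (freeToSigma_single_element F x g).symm))

include hT hfull hproj hfp in
lemma sieve_range_unit_mem (η : M ⟶ (restrictedYoneda k F).obj (cokernel (relationMap F hM)))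
    (hη : tautological hM ≫ η = freeToCokernel F hM) (X : A)
    (y : F.obj X ⟶ cokernel (relationMap F hM)) :
    (rangeSub η).sieve (restrictedYoneda_isRightModule F _) (X := X) y ∈ T X := by
  refine hT.sieve_mem_of_forall _ _ _ (sieve_range_freeToSigma_comp_mem hT F hfull hfp _ hproj
    (cokernel.π (relationMap F hM)) y) fun W g hg => ?_
  obtain ⟨c, hc⟩ := hg
  exact ⟨((tautological hM).app (op W)).hom c,
    (congrArg (fun φ => (φ.app (op W)).hom c) hη).trans hc⟩

include hM hT hfull hproj hfp in
lemma exists_restrictedYoneda_iso [F.Faithful] (hample : IsTAmple T F) (hM' : IsLinearSheaf T M) :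
    ∃ X : C, Nonempty ((restrictedYoneda k F).obj X ≅ M) := by
  obtain ⟨η, hη⟩ := exists_unit F hM
  have hinj := unit_injective F hM hT hfull hproj hfp hM'.isSeparated η hη
  have hsurj := surjective_of_isLinearSheaf hM' (restrictedYoneda_isRightModule F _)
    ((isTAmple_iff T F).1 hample _) η hinj (sieve_range_unit_mem F hM hT hfull hproj hfp η hη)
  have : ∀ X, IsIso (η.app X) := fun X =>
    (ConcreteCategory.isIso_iff_bijective _).2 ⟨hinj X.unop, hsurj X.unop⟩
  have : IsIso η := NatIso.isIso_of_isIso_app η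
  exact ⟨_, ⟨(asIso η).symm⟩⟩

end Localization

/-- Sufficient conditions for `C(F(-), -)` to be an equivalence onto the category of sheaves. -/
theorem exists_isEquivalence_sh [F.Faithful] {T : CoveringSystem k A} (hT : IsTopology T)
    (hfull : IsTFull T F) (hsep : IsSeparatingFunctor F) (hample : IsTAmple T F)
    (hproj : IsTProjective T F) (hfp : IsTFinitelyPresented T F) :
    ∃ e : C ⥤ Sh T, e.IsEquivalence ∧
      Nonempty (e ⋙ (sheafProperty T).ι ≅ restrictedYoneda k F) := by
  rw [isTFinitelyPresented_iff] at hfp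
  have hf := restrictedYoneda_full hT F hfull hsep hample hfp
  have hf' := restrictedYoneda_faithful k F hsep
  let e : C ⥤ Sh T := (sheafProperty T).lift (restrictedYoneda k F) fun Y =>
    ⟨restrictedYoneda_isRightModule F Y,
      restrictedYoneda_isLinearSheaf hT F hfull hsep hample hfp Y⟩
  have : e.EssSurj := ⟨fun M => by
    obtain ⟨X, ⟨α⟩⟩ := exists_restrictedYoneda_iso F M.property.1 hT hfull hproj hfp hample
      M.property.2
    exact ⟨X, ⟨(sheafProperty T).isoMk α⟩⟩⟩
  let α : e ⋙ (sheafProperty T).ι ≅ restrictedYoneda k F := Iso.refl _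
  have : e.Full := Functor.Full.of_comp_faithful_iso α
  have : e.Faithful := Functor.Faithful.of_comp_iso α
  have : e.IsEquivalence := { }
  exact ⟨e, this, ⟨α⟩⟩

end EssentialImage

end LinTop

end

namespace LinTop

/-! ### The tails covering system and the explicit conditions. -/

namespace ZAlg

section

variable {C : Type u} [Category.{v} C] [Preadditive C] (O : ℤ → C)

instance : (toC O).Additive where
  map_add := rfl

instance : (toC O).Faithful where
  map_injective h := Subtype.ext h

variable {k : Type w} [CommRing k] [Linear k C]

instance : (toC O).Linear k where
  map_smul _ _ := rfl

variable {O}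

/-- The morphism of the `ℤ`-algebra given by a morphism `O(-n) ⟶ O(-m)` with `m ≤ n`. -/
def homOfLE {X Y : ZAlg O} (h : Y.deg ≤ X.deg) (f : O (-X.deg) ⟶ O (-Y.deg)) : X ⟶ Y :=
  ⟨f, fun h' => absurd h' (not_lt.2 h)⟩

lemma mem_tail_of_le {X Y : ZAlg O} {n : ℤ} (h : n ≤ Y.deg) (f : Y ⟶ X) :
    f ∈ (tail k X n).carrier Y := fun h' => absurd h' (not_lt.2 h)

lemma tail_mem_LTails (X : ZAlg O) {n : ℤ} (h : X.deg ≤ n) : tail k X n ∈ LTails k O X :=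
  ⟨n, h, fun _ _ hf => hf⟩

/-- A property of morphisms that holds for zero morphisms holds on a covering of `X` if and only if
it holds for all morphisms `O(-n) ⟶ O(-X)` with `n` large. -/
lemma exists_mem_LTails_iff (X : ZAlg O) (P : ∀ n : ℤ, (O (-n) ⟶ O (-X.deg)) → Prop)
    (hP : ∀ n, P n 0) :
    (∃ R ∈ LTails k O X, ∀ (Y : ZAlg O) (g : Y ⟶ X), g ∈ R.carrier Y →
      P Y.deg ((toC O).map g)) ↔
    ∃ n₀ : ℤ, X.deg ≤ n₀ ∧ ∀ n : ℤ, n₀ ≤ n → ∀ g : O (-n) ⟶ O (-X.deg), P n g := by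
  constructor
  · rintro ⟨R, ⟨n₀, h₀, hR⟩, h⟩
    exact ⟨n₀, h₀, fun n hn g => h ⟨n⟩ (homOfLE (X := ⟨n⟩) (h₀.trans hn) g)
      (hR _ (mem_tail_of_le hn _))⟩
  · rintro ⟨n₀, h₀, h⟩
    refine ⟨_, tail_mem_LTails X h₀, fun Y g hg => ?_⟩
    -- Below degree `n₀` the tail contains only zero morphisms, which is why `P` is required at
    -- zero.
    rcases lt_or_ge Y.deg n₀ with hlt | hge
    · rw [hg hlt, Functor.map_zero]
      exact hP _
    · exact h _ hge _

lemma isTFull_toC : IsTFull (LTails k O) (toC O) := fun {X Y} h => by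
  refine (exists_mem_LTails_iff X (fun n g => ∃ g' : (⟨n⟩ : ZAlg O) ⟶ Y, (toC O).map g' = g ≫ h)
    -- Degrees at least `Y.deg` make `g ≫ h` a morphism of the ℤ-algebra; the bound `X.deg` belongs
    -- to the definition of a tail.
    fun n => ⟨0, zero_comp.symm⟩).2 ⟨max X.deg Y.deg, le_max_left _ _, fun n hn g => ?_⟩
  exact ⟨homOfLE (X := ⟨n⟩) ((le_max_right _ _).trans hn) (g ≫ h), rfl⟩

end

section Abelian

variable {C : Type u} [Category.{v} C] [Abelian C] (O : ℤ → C)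
  (k : Type w) [CommRing k] [Linear k C]

lemma isTProjective_toC_iff : IsTProjective (LTails k O) (toC O) ↔ TailsProjective O := by
  rw [isTProjective_iff]
  have key {X Y : C} (c : X ⟶ Y) (Z : ZAlg O) (f : (toC O).obj Z ⟶ Y) :=
    exists_mem_LTails_iff (k := k) Z (fun n g => ∃ h : O (-n) ⟶ X, h ≫ c = g ≫ f)
      fun n => ⟨0, zero_comp.trans zero_comp.symm⟩
  exact ⟨fun H X Y c hc m f => (key c ⟨m⟩ f).1 (H c hc ⟨m⟩ f),
    fun H X Y c hc Z f => (key c Z f).2 (H X Y c hc Z.deg f)⟩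

end Abelian

section Grothendieck

variable {C : Type u} [Category.{v} C] [Abelian C] [IsGrothendieckAbelian.{v} C] (O : ℤ → C)

lemma isSeparatingFunctor_toC_iff : IsSeparatingFunctor (toC O) ↔ Generates O := by
  -- The sign in O(-n) is harmless, because n ↦ -n is onto ℤ.
  have hneg {X Y : C} (a b : X ⟶ Y) : (∀ (Z : ZAlg O) (x : (toC O).obj Z ⟶ X), x ≫ a = x ≫ b) ↔
      ∀ (n : ℤ) (x : O n ⟶ X), x ≫ a = x ≫ b := by
    refine ⟨fun h n => ?_, fun h Z x => h (-Z.deg) x⟩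
    obtain ⟨m, rfl⟩ := neg_surjective n
    exact h ⟨m⟩
  constructor
  · intro h X
    refine ⟨Σ n : ℤ, (O n ⟶ X), fun i => i.1, Sigma.desc fun i => i.2, ⟨fun a b hab => ?_⟩⟩
    refine h a b ((hneg a b).2 fun n x => ?_)
    have := Sigma.ι (fun i : (Σ n : ℤ, (O n ⟶ X)) => O i.1) ⟨n, x⟩ ≫= hab
    rwa [Sigma.ι_desc_assoc, Sigma.ι_desc_assoc] at this
  · intro h X Y a b hab
    obtain ⟨I, n, p, _⟩ := h X
    rw [← cancel_epi p]
    refine Sigma.hom_ext _ _ fun i => ?_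
    rw [← Category.assoc, ← Category.assoc]
    exact (hneg a b).1 hab (n i) _

variable (k : Type w) [CommRing k] [Linear k C]

lemma isTAmple_toC_iff : IsTAmple (LTails k O) (toC O) ↔ TailsAmple O := by
  rw [isTAmple_iff]
  constructor
  · intro H m n hmn
    refine ⟨Σ l : {l : ℤ // n ≤ l}, (O (-l.1) ⟶ O (-m)), fun i => i.1.1, Sigma.desc fun i => i.2,
      fun i => i.1.2, Preadditive.epi_of_cancel_zero _ fun {Y} x hx => ?_⟩
    refine H Y ⟨m⟩ _ (tail_mem_LTails (k := k) (⟨m⟩ : ZAlg O) hmn) x fun Z f hf => ?_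
    rcases lt_or_ge Z.deg n with hlt | hge
    · rw [hf hlt]
      exact zero_comp
    · have := Sigma.ι (fun i : (Σ l : {l : ℤ // n ≤ l}, (O (-l.1) ⟶ O (-m))) => O (-i.1.1))
        ⟨⟨Z.deg, hge⟩, (toC O).map f⟩ ≫= hx
      rwa [Sigma.ι_desc_assoc, comp_zero] at this
  · rintro H Y X R ⟨n, hn, hR⟩ x hx
    obtain ⟨I, ν, p, hν, _⟩ := H X.deg n hn
    -- Each component of `p` has source degree `ν i ≥ n`, so it lies in the tail contained in `R`.
    refine zero_of_epi_comp p (Sigma.hom_ext _ _ fun i => ?_)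
    have h : (Sigma.ι (fun i => O (-ν i)) i ≫ p) ≫ x = 0 :=
      hx ⟨ν i⟩ (homOfLE (X := ⟨ν i⟩) (hn.trans (hν i)) (Sigma.ι (fun i => O (-ν i)) i ≫ p))
        (hR _ (mem_tail_of_le (hν i) _))
    exact (Category.assoc _ _ _).symm.trans (h.trans comp_zero.symm)

lemma isTFinitelyPresented_toC_iff :
    IsTFinitelyPresented (LTails k O) (toC O) ↔ TailsFinitelyPresented O := by
  rw [isTFinitelyPresented_iff]
  have key₁ {J : Type v} [SmallCategory J] [IsFiltered J] {D : J ⥤ C} (c : Cocone D)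
      (Z : ZAlg O) (f : (toC O).obj Z ⟶ c.pt) :=
    exists_mem_LTails_iff (k := k) Z
      (fun n g => ∃ (i : J) (h : O (-n) ⟶ D.obj i), h ≫ c.ι.app i = g ≫ f)
      fun n => ⟨(IsFiltered.nonempty (C := J)).some, 0, zero_comp.trans zero_comp.symm⟩
  have key₂ {J : Type v} [SmallCategory J] {D : J ⥤ C} (Z : ZAlg O) (i : J)
      (f : (toC O).obj Z ⟶ D.obj i) :=
    exists_mem_LTails_iff (k := k) Z
      (fun n g => ∃ (j : J) (a : i ⟶ j), g ≫ f ≫ D.map a = 0)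
      fun n => ⟨i, 𝟙 i, zero_comp⟩
  constructor
  · intro H J _ _ D c hc m
    exact ⟨fun f => (key₁ c ⟨m⟩ f).1 ((H J D c hc ⟨m⟩).1 f),
      fun i f hf => (key₂ ⟨m⟩ i f).1 ((H J D c hc ⟨m⟩).2 i f hf)⟩
  · intro H J _ _ D c hc Z
    exact ⟨fun f => (key₁ c Z f).2 ((H J D c hc Z.deg).1 f),
      fun i f hf => (key₂ Z i f).2 ((H J D c hc Z.deg).2 i f hf)⟩

end Grothendieck

end ZAlg

end LinTop

open LinTop LinTop.ZAlg
theorem theorem3 {k : Type w} [CommRing k] {C : Type u} [Category.{v} C] [Abelian C]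
    [IsGrothendieckAbelian.{v} C] [Linear k C] (O : ℤ → C)
    (hL : LTails k O = TTails k O) :
    (IsZGenerating k O ↔
      Generates O ∧ IsTAmple (LTails k O) (toC O) ∧ IsTProjective (LTails k O) (toC O) ∧
        IsTFinitelyPresented (LTails k O) (toC O)) ∧
    (IsTAmple (LTails k O) (toC O) ↔ TailsAmple O) ∧
    (IsTProjective (LTails k O) (toC O) ↔ TailsProjective O) ∧
    (IsTFinitelyPresented (LTails k O) (toC O) ↔ TailsFinitelyPresented O) := by
  refine ⟨?_, isTAmple_toC_iff O k, isTProjective_toC_iff O k, isTFinitelyPresented_toC_iff O k⟩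
  have hT : IsTopology (TTails k O) := generatedTopology_isTopology _
  have hfull : IsTFull (TTails k O) (toC O) := hL ▸ isTFull_toC
  -- All conditions now refer to the generated topology, where the general results apply.
  rw [hL, ← isSeparatingFunctor_toC_iff]
  constructor
  · rintro ⟨e, _, ⟨iso⟩⟩
    have : (restrictedYoneda k (toC O)).Faithful := Functor.Faithful.of_iso iso
    exact ⟨isSeparatingFunctor_of_faithful (k := k) _, isTAmple_of_iso iso,
      isTProjective_of_isEquivalence iso hT, isTFinitelyPresented_of_isEquivalence iso hT⟩
  · rintro ⟨hsep, hample, hproj, hfp⟩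
    exact exists_isEquivalence_sh (toC O) hT hfull hsep hample hproj hfp
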